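/- A (finite, compact) metric graph $G$ is obtained from finitely many intervals $[0,\ell_e]$, $\ell_e>0$ ($e\in\mathcal E$), by gluing their ends together at finitely many vertices; the degree of a vertex is the number of edge ends glued there, a leaf is a vertex of degree $1$, and $G$ is a tree if it is connected and has no cycles. For a bounded measurable potential $q:G\to\mathbb R$ let $\lambda_1(G,q)\le\lambda_2(G,q)\le\dots$ be the eigenvalues, counted with multiplicity, of the operator $-u''+qu$ on $L^2(G)$ with standard vertex conditions ($u$ is continuous on $G$, and at every vertex the derivatives of $u$ along the incident edges, directed away from the vertex, sum to $0$), and let $\Gamma[q]=\lambda_2(G,q)-\lambda_1(G,q)$. If $G$ is a tree and $M>0$, let $C_{G,M}$ be the set of all $q:G\to\mathbb R$ with $0\le q\le M$ that are convex along each path joining two distinct leaves of $G$, each such path being regarded, via arc length, as a compact interval. Let $G$ be a tree of total length $L=\sum_{e}\ell_e>0$. Suppose that there are a real eigenfunction $u_2$ of the Laplacian ($q=0$) on $G$ for the eigenvalue $\lambda_2(G,0)$ and a leaf $v$ of $G$ such that $$u_2(v)^2<\frac1L\int_G u_2(x)^2\,\mathrm dx .$$ Then, for every $M>0$, the potential $q=0$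 does not minimize $\Gamma$ in $C_{G,M}$, i.e. there is $q\in C_{G,M}$ with $\Gamma[q]<\Gamma[0]$. In particular, this conclusion holds if some eigenfunction $u_2$ for $\lambda_2(G,0)$ satisfies $u_2(v)=0$ at some leaf $v$. -/

import Mathlib

open Set MeasureTheory

/-- A finite metric graph: every edge `e` is a compact interval `[0, len e]`, with the end `0` glued
to the vertex `src e` and the end `len e` glued to the vertex `tgt e`. Loops and parallel edges are
allowed; the orientation of the edges is only a choice of coordinates. -/
structure MetricGraph (V E : Type*) where
  src : E → V
  tgt : E → V
  len : E → ℝ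
  len_pos : ∀ e, 0 < len e

namespace MetricGraph

/-- The points of the metric graph: vertices, and interior points of edges. -/
inductive Point {V E : Type*} (G : MetricGraph V E) : Type _ where
  | vertex (v : V) : Point G
  | interior (e : E) (x : ℝ) (hx : x ∈ Ioo 0 (G.len e)) : Point G

section

variable {V E : Type*} (G : MetricGraph V E)

/-- The point of `G` with coordinate `x ∈ [0, len e]` on the edge `e`. -/
noncomputable def pt (e : E) (x : ℝ) : G.Point :=
  if hx : x ∈ Ioo 0 (G.len e) then Point.interior e x hx
  else if x ≤ 0 then Point.vertex (G.src e) else Point.vertex (G.tgt e)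

/-- Adjacency of distinct vertices. -/
def toSimpleGraph : SimpleGraph V :=
  SimpleGraph.fromRel fun a b => ∃ e, G.src e = a ∧ G.tgt e = b

/-- `G` is connected and has no cycles: there are no loops (cycles with one edge), no parallel edges
(cycles with two edges), and the adjacency graph is connected and without cycles. -/
structure IsTree : Prop where
  loopless : ∀ e, G.src e ≠ G.tgt e
  no_parallel : ∀ e f, s(G.src e, G.tgt e) = s(G.src f, G.tgt f) → e = f
  isTree : G.toSimpleGraph.IsTree

/-! ### Paths of edges, parametrized by arc length -/

/-- The initial vertex of an edge traversed forwards (`true`) or backwards (`false`). -/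
def origin (d : E × Bool) : V := if d.2 then G.src d.1 else G.tgt d.1

/-- The final vertex of an edge traversed forwards (`true`) or backwards (`false`). -/
def terminus (d : E × Bool) : V := if d.2 then G.tgt d.1 else G.src d.1

/-- The list of oriented edges is a walk from the first to the second vertex. -/
def IsWalk : V → List (E × Bool) → V → Prop
  | a, [], b => a = b
  | a, d :: l, b => G.origin d = a ∧ IsWalk (G.terminus d) l b

/-- A walk that visits no vertex twice. -/
def IsPath (a : V) (l : List (E × Bool)) (b : V) : Prop :=
  G.IsWalk a l b ∧ (a :: l.map G.terminus).Nodup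

/-- The length of a walk. -/
def pathLength (l : List (E × Bool)) : ℝ := (l.map fun d => G.len d.1).sum

/-- The point reached at time `t ∈ [0, pathLength l]` on walking along `l` from the given vertex at
unit speed. -/
noncomputable def trace : V → List (E × Bool) → ℝ → G.Point
  | a, [], _ => Point.vertex a
  | _, d :: l, t =>
      if t ≤ G.len d.1 then G.pt d.1 (if d.2 then t else G.len d.1 - t)
      else trace (G.terminus d) l (t - G.len d.1)

end

section

variable {V E : Type*} [DecidableEq V] [Fintype E] (G : MetricGraph V E)

/-- The degree of a vertex: the number of edge ends glued to it. -/
def degree (v : V) : ℕ :=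
  (Finset.univ.filter fun e => G.src e = v).card + (Finset.univ.filter fun e => G.tgt e = v).card

/-- A leaf (boundary vertex) is a vertex of degree one. -/
def IsLeaf (v : V) : Prop := G.degree v = 1

/-- The class `C_{G,M}` of potentials with values in `[0, M]` that are convex along every path from
a leaf to another leaf, the path being regarded as an interval. -/
def convexClass (M : ℝ) : Set (G.Point → ℝ) :=
  {q | (∀ x, 0 ≤ q x ∧ q x ≤ M) ∧
    ∀ a b, G.IsLeaf a → G.IsLeaf b → a ≠ b → ∀ l, G.IsPath a l b →
      ConvexOn ℝ (Icc 0 (G.pathLength l)) fun t => q (G.trace a l t)}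

/-- `u` belongs to the domain of the Schrödinger operators on `G` with Kirchhoff conditions, and
`du e`, `ddu e` are its first and second derivative on the edge `e`. That is: on every edge `u` is
`C¹` up to the ends and `u'` is the primitive of a function `u''` in `L²` (i.e. `u ∈ W^{2,2}`);
`u` is continuous on `G` (being one function on the points of `G`, it has one value at every
vertex); and at every vertex the derivatives in the directions of the incident edges sum to `0`. -/
structure InDomain (u : G.Point → ℝ) (du ddu : E → ℝ → ℝ) : Prop where
  hasDeriv : ∀ e, ∀ x ∈ Icc 0 (G.len e),
    HasDerivWithinAt (fun y => u (G.pt e y)) (du e x) (Icc 0 (G.len e)) x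
  memLp : ∀ e, MemLp (ddu e) 2 (volume.restrict (Ioo 0 (G.len e)))
  primitive : ∀ e, ∀ x ∈ Icc 0 (G.len e), du e x = du e 0 + ∫ y in (0 : ℝ)..x, ddu e y
  kirchhoff : ∀ v, (∑ e with G.src e = v, du e 0) - (∑ e with G.tgt e = v, du e (G.len e)) = 0

/-- `u` is an eigenfunction of `H u = -u'' + q u` (with Kirchhoff conditions) for the eigenvalue
`μ`. -/
def IsEigenfunction (q : G.Point → ℝ) (μ : ℝ) (u : G.Point → ℝ) : Prop :=
  u ≠ 0 ∧ ∃ du ddu : E → ℝ → ℝ, G.InDomain u du ddu ∧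
    ∀ e, ∀ᵐ x ∂(volume.restrict (Ioo 0 (G.len e))),
      -ddu e x + q (G.pt e x) * u (G.pt e x) = μ * u (G.pt e x)

/-- The `n`-th eigenvalue of `-Δ + q` (`n = 1, 2, …`), in increasing order and counted with
multiplicity: the least `μ` such that there are `n` linearly independent eigenfunctions with
eigenvalues at most `μ`. -/
noncomputable def eigenvalue (q : G.Point → ℝ) (n : ℕ) : ℝ :=
  sInf {μ | ∃ w : Fin n → G.Point → ℝ, LinearIndependent ℝ w ∧
    ∀ i, ∃ ν ≤ μ, G.IsEigenfunction q ν (w i)}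

/-- The fundamental gap `Γ[q] = λ₂(q) - λ₁(q)`. -/
noncomputable def gap (q : G.Point → ℝ) : ℝ := G.eigenvalue q 2 - G.eigenvalue q 1

end

section

variable {V E : Type*} [Fintype E] (G : MetricGraph V E)

/-- The total length of `G`. -/
def totalLength : ℝ := ∑ e, G.len e

/-- The integral over `G` with respect to arc length. -/
noncomputable def integral (f : G.Point → ℝ) : ℝ := ∑ e, ∫ x in (0 : ℝ)..G.len e, f (G.pt e x)

end

end MetricGraph

/-! The gap decreases to first order along a small potential concentrated at the leaf `v`. Write `L`
for the total length. For a potential `q`, the derivative of `λ₁(s q)` at `s = 0` is the mean `(1/L)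
∫ q`, because the ground state is constant, while `λ₂(s q)` grows at first order by at most `∫ q u₂²
/ ∫ u₂²`; only this upper bound is needed, so `λ₂` may be multiple. Take `q = max (0, δ - dist (v,
·))` on the leaf edge and zero elsewhere. For small `δ`, continuity keeps `u₂²` on its support below
a number less than the mean of `u₂²`, so the second slope is smaller than the first. A path between
distinct leaves can use the leaf edge only as its first or last edge, hence `q` is convex along it
(`convexOn_leafPotential`).

No derivative of an eigenvalue is taken. With `c < a` strictly between the two slopes, the energy on
the span of `1` and `u₂` gives `λ₂(s q) ≤ λ₂(0) + s c` (`rayleigh_upper_bound`), and splitting a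
function into its mean and the rest gives `λ₁(s q) ≥ s a` (`rayleigh_lower_bound`), both for small
`s`; `exists_gap_smul_lt` combines them.

Eigenvalues are defined through eigenfunctions, so a bound from test functions must produce genuine
eigenfunctions. The direct method does so: forms on a closed subspace of pairs (vertex values, edge
derivatives), a Rayleigh minimizer found by compactness and coercivity, a second one orthogonal to
it (`exists_pair_weak_eigenvectors`), and the equivalence of weak and strong eigenfunctions
(`IsEigenfunction.exists_weak`, `isEigenfunction_of_weak`). -/

namespace MetricGraph

/-! ### Minimization of Rayleigh quotients for abstract symmetric forms. -/

section Variational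

open Filter Topology

variable {X : Type*} [NormedAddCommGroup X] [NormedSpace ℝ X]

theorem bilin_self_add_smul (a : X →L[ℝ] X →L[ℝ] ℝ) (hs : ∀ x y, a x y = a y x) (s t : ℝ)
    (x y : X) :
    a (s • x + t • y) (s • x + t • y) = s ^ 2 * a x x + 2 * s * t * a x y + t ^ 2 * a y y := by
  simp only [map_add, map_smul, add_apply, smul_apply,
    smul_eq_mul, hs y x]
  ring

/-- A vector at which a symmetric form that is nonnegative on `W` vanishes is orthogonal to `W`. -/
theorem bilin_eq_zero_of_nonneg (Q : X →L[ℝ] X →L[ℝ] ℝ) (hs : ∀ x y, Q x y = Q y x)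
    (W : Submodule ℝ X) (hpos : ∀ w ∈ W, 0 ≤ Q w w) {u : X} (hu : u ∈ W) (h0 : Q u u = 0)
    {w : X} (hw : w ∈ W) : Q u w = 0 := by
  have key : ∀ t : ℝ, 0 ≤ 2 * t * Q u w + t ^ 2 * Q w w := fun t => by
    have h := hpos _ (W.add_mem (W.smul_mem 1 hu) (W.smul_mem t hw))
    rw [bilin_self_add_smul Q hs, h0] at h
    linarith
  have hw0 := hpos w hw
  by_contra hne
  -- A `t` close to the minimizer of the quadratic; the added `1` allows `Q w w = 0` and still
  -- leaves a negative value.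
  have h1 := key (-(Q u w) / (Q w w + 1))
  have h2 : 2 * (-(Q u w) / (Q w w + 1)) * Q u w + (-(Q u w) / (Q w w + 1)) ^ 2 * Q w w
      = -((Q u w) ^ 2 * (Q w w + 2)) / (Q w w + 1) ^ 2 := by
    field_simp
    ring
  rw [h2] at h1
  have h3 : 0 < (Q u w) ^ 2 * (Q w w + 2) := by positivity
  have h4 : -((Q u w) ^ 2 * (Q w w + 2)) / (Q w w + 1) ^ 2 < 0 :=
    div_neg_of_neg_of_pos (by linarith) (by positivity)
  linarith

/-- The Rayleigh quotient `a / b` attains its minimum on a closed subspace if `a + b` is coercive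
there and bounded sequences have `b`-Cauchy subsequences. -/
theorem exists_rayleigh_minimizer [CompleteSpace X] (a b : X →L[ℝ] X →L[ℝ] ℝ)
    (has : ∀ x y, a x y = a y x) (hbs : ∀ x y, b x y = b y x)
    (hb : ∀ x, 0 ≤ b x x) (W : Submodule ℝ X) (hW : IsClosed (W : Set X))
    (ha : ∀ x ∈ W, 0 ≤ a x x)
    {C : ℝ} (hC : ∀ x ∈ W, ‖x‖ ^ 2 ≤ C * (a x x + b x x))
    (hcpt : ∀ (x : ℕ → X) (R : ℝ), (∀ n, ‖x n‖ ≤ R) → ∃ φ : ℕ → ℕ, StrictMono φ ∧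
      ∀ ε > 0, ∃ N, ∀ m ≥ N, ∀ n ≥ N, b (x (φ m) - x (φ n)) (x (φ m) - x (φ n)) < ε)
    {z : X} (hz : z ∈ W) (hbz : 0 < b z z) :
    ∃ u ∈ W, ∃ μ : ℝ, b u u = 1 ∧ (∀ w ∈ W, a u w = μ * b u w) ∧
      ∀ w ∈ W, μ * b w w ≤ a w w := by
  set S : Set ℝ := {r | ∃ w ∈ W, b w w = 1 ∧ a w w = r} with hS
  have hscale : ∀ w ∈ W, 0 < b w w → a w w / b w w ∈ S := fun w hw hbw => by
    have h1 : (Real.sqrt (b w w)) ^ 2 = b w w := Real.sq_sqrt hbw.le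
    have h2 : Real.sqrt (b w w) ≠ 0 := (Real.sqrt_pos.2 hbw).ne'
    refine ⟨(Real.sqrt (b w w))⁻¹ • w, W.smul_mem _ hw, ?_, ?_⟩
    · simp only [map_smul, smul_apply, smul_eq_mul]
      rw [← mul_assoc, ← mul_inv, ← sq, h1, inv_mul_cancel₀ hbw.ne']
    · simp only [map_smul, smul_apply, smul_eq_mul]
      rw [← mul_assoc, ← mul_inv, ← sq, h1, inv_mul_eq_div]
  have hSne : S.Nonempty := ⟨_, hscale z hz hbz⟩
  have hSbdd : BddBelow S := ⟨0, by rintro _ ⟨w, hw, -, rfl⟩; exact ha w hw⟩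
  set μ := sInf S with hμ
  have hμ0 : 0 ≤ μ := le_csInf hSne (by rintro _ ⟨w, hw, -, rfl⟩; exact ha w hw)
  have hmin : ∀ w ∈ W, μ * b w w ≤ a w w := fun w hw => by
    rcases (hb w).eq_or_lt with h | h
    · rw [← h, mul_zero]; exact ha w hw
    · exact (le_div_iff₀ h).1 (csInf_le hSbdd (hscale w hw h))
  obtain ⟨r, -, hr, hrS⟩ := exists_seq_tendsto_sInf hSne hSbdd
  choose x hxW hxb hxa using hrS
  have hrμ : ∀ n, μ ≤ r n := fun n => csInf_le hSbdd ⟨x n, hxW n, hxb n, hxa n⟩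
  have hC0 : 0 ≤ C := by
    have h := hC z hz
    have h1 := ha z hz
    by_contra hneg
    have h2 : C * (a z z + b z z) < 0 := mul_neg_of_neg_of_pos (not_le.1 hneg) (by linarith)
    linarith [sq_nonneg ‖z‖]
  obtain ⟨B, hB⟩ := hr.bddAbove_range
  have hxbd : ∀ n, ‖x n‖ ≤ Real.sqrt (C * (B + 1)) := fun n => by
    refine Real.le_sqrt_of_sq_le ((hC _ (hxW n)).trans ?_)
    rw [hxa, hxb]
    exact mul_le_mul_of_nonneg_left (by linarith [hB ⟨n, rfl⟩]) hC0
  obtain ⟨φ, hφ, hcau⟩ := hcpt x _ hxbd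
  have hr' : Tendsto (fun n => r (φ n)) atTop (𝓝 μ) := hr.comp hφ.tendsto_atTop
  -- Parallelogram law: `a` of the difference is `2 r m + 2 r n` minus `a` of the sum, and the
  -- latter is at least `μ` times `b` of the sum, which is `4` minus `b` of the difference. So
  -- `b`-Cauchy upgrades to `a`-Cauchy along a minimizing sequence.
  have hdiff : ∀ m n, a (x m - x n) (x m - x n)
      ≤ 2 * (r m - μ) + 2 * (r n - μ) + μ * b (x m - x n) (x m - x n) := fun m n => by
    have h1 := bilin_self_add_smul a has 1 (-1) (x m) (x n)
    have h2 := bilin_self_add_smul a has 1 1 (x m) (x n)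
    have h3 := bilin_self_add_smul b hbs 1 (-1) (x m) (x n)
    have h4 := bilin_self_add_smul b hbs 1 1 (x m) (x n)
    have h5 := hmin _ (W.add_mem (W.smul_mem 1 (hxW m)) (W.smul_mem 1 (hxW n)))
    simp only [one_smul, neg_smul, ← sub_eq_add_neg, hxa, hxb] at h1 h2 h3 h4 h5
    rw [h2, h4] at h5
    rw [h1, h3]
    linarith
  have hCauchy : CauchySeq fun n => x (φ n) := by
    rw [Metric.cauchySeq_iff]
    intro ε hε
    have hε2 : 0 < ε ^ 2 := by positivity
    -- With all three errors below `η`, `hdiff` gives `a + b ≤ (μ + 5) η` on the difference; the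
    -- enlarged factors `C + 1` and `μ + 6` keep the denominator positive and the final inequality
    -- strict.
    set η := ε ^ 2 / ((C + 1) * (μ + 6)) with hη
    have hη0 : 0 < η := by positivity
    obtain ⟨N₁, hN₁⟩ := hcau η hη0
    obtain ⟨N₂, hN₂⟩ := (Metric.tendsto_atTop.1 hr') η hη0
    refine ⟨max N₁ N₂, fun m hm n hn => ?_⟩
    have e1 := hN₁ m (le_of_max_le_left hm) n (le_of_max_le_left hn)
    have e2 := hN₂ m (le_of_max_le_right hm)
    have e3 := hN₂ n (le_of_max_le_right hn)
    rw [Real.dist_eq] at e2 e3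
    have e4 := (abs_lt.1 e2).2
    have e5 := (abs_lt.1 e3).2
    have e6 := hdiff (φ m) (φ n)
    have e7 := hC _ (W.sub_mem (hxW (φ m)) (hxW (φ n)))
    set d := b (x (φ m) - x (φ n)) (x (φ m) - x (φ n)) with hd
    have hd0 : 0 ≤ d := hb _
    have e8 : μ * d ≤ μ * η := mul_le_mul_of_nonneg_left e1.le hμ0
    have e9 : a (x (φ m) - x (φ n)) (x (φ m) - x (φ n)) + d ≤ (μ + 5) * η := by linarith
    have e10 : ‖x (φ m) - x (φ n)‖ ^ 2 ≤ C * ((μ + 5) * η) :=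
      e7.trans (mul_le_mul_of_nonneg_left e9 hC0)
    have e11 : C * ((μ + 5) * η) < ε ^ 2 := by
      have : ε ^ 2 = (C + 1) * ((μ + 6) * η) := by rw [hη]; field_simp
      rw [this]
      have h1 : 0 ≤ C * η := by positivity
      have h2 : 0 < (μ + 6) * η := by positivity
      nlinarith
    rw [dist_eq_norm]
    exact lt_of_pow_lt_pow_left₀ 2 hε.le (e10.trans_lt e11)
  obtain ⟨u, hu⟩ := cauchySeq_tendsto_of_complete hCauchy
  have huW : u ∈ W := hW.mem_of_tendsto hu (Eventually.of_forall fun n => hxW _)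
  have hlim : ∀ c : X →L[ℝ] X →L[ℝ] ℝ,
      Tendsto (fun n => c (x (φ n)) (x (φ n))) atTop (𝓝 (c u u)) := fun c => by
    have : Continuous fun y : X => c y y := by fun_prop
    exact (this.tendsto u).comp hu
  have hbu : b u u = 1 := tendsto_nhds_unique (hlim b) (by simp only [hxb]; exact tendsto_const_nhds)
  have hau : a u u = μ := tendsto_nhds_unique (hlim a) (by simpa only [hxa] using hr')
  refine ⟨u, huW, μ, hbu, fun w hw => ?_, hmin⟩
  -- Euler–Lagrange equation: `a - μ b` is nonnegative on `W` and vanishes at `u`.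
  have := bilin_eq_zero_of_nonneg (a - μ • b) (fun x y => by simp [has x y, hbs x y]) W
    (fun w hw => by simpa using hmin w hw) huW (by simp [hau, hbu]) hw
  simpa [sub_eq_zero] using this

/-- If `a ≤ Λ b` on the span of two vectors of `K` on which `b` is definite, then there are two
`b`-orthonormal weak eigenvectors with eigenvalues at most `Λ`. -/
theorem exists_pair_weak_eigenvectors [CompleteSpace X] (a b : X →L[ℝ] X →L[ℝ] ℝ)
    (has : ∀ x y, a x y = a y x) (hbs : ∀ x y, b x y = b y x)
    (hb : ∀ x, 0 ≤ b x x) (K : Submodule ℝ X) (hK : IsClosed (K : Set X))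
    (ha : ∀ x ∈ K, 0 ≤ a x x)
    {C : ℝ} (hC : ∀ x ∈ K, ‖x‖ ^ 2 ≤ C * (a x x + b x x))
    (hcpt : ∀ (x : ℕ → X) (R : ℝ), (∀ n, ‖x n‖ ≤ R) → ∃ φ : ℕ → ℕ, StrictMono φ ∧
      ∀ ε > 0, ∃ N, ∀ m ≥ N, ∀ n ≥ N, b (x (φ m) - x (φ n)) (x (φ m) - x (φ n)) < ε)
    {y z : X} (hy : y ∈ K) (hz : z ∈ K) {Λ : ℝ}
    (hpos : ∀ s t : ℝ, (s ≠ 0 ∨ t ≠ 0) → 0 < b (s • y + t • z) (s • y + t • z))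
    (hle : ∀ s t : ℝ, a (s • y + t • z) (s • y + t • z) ≤
      Λ * b (s • y + t • z) (s • y + t • z)) :
    ∃ u ∈ K, ∃ w ∈ K, ∃ μ ≤ Λ, ∃ ν ≤ Λ, b u u = 1 ∧ b w w = 1 ∧ b u w = 0 ∧
      (∀ h ∈ K, a u h = μ * b u h) ∧ ∀ h ∈ K, a w h = ν * b w h := by
  have hby : 0 < b ((1 : ℝ) • y + (0 : ℝ) • z) ((1 : ℝ) • y + (0 : ℝ) • z) :=
    hpos 1 0 (Or.inl one_ne_zero)
  have hmem : ∀ s t : ℝ, s • y + t • z ∈ K := fun s t =>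
    K.add_mem (K.smul_mem s hy) (K.smul_mem t hz)
  obtain ⟨u, huK, μ, hbu, hu, hμmin⟩ := exists_rayleigh_minimizer a b has hbs hb K hK ha hC hcpt
    (hmem 1 0) hby
  set W : Submodule ℝ X := K ⊓ (b u).toLinearMap.ker with hWdef
  have hWK : ∀ x ∈ W, x ∈ K := fun x hx => hx.1
  have hWu : ∀ x ∈ W, b u x = 0 := fun x hx => hx.2
  have hW : IsClosed (W : Set X) := hK.inter (b u).isClosed_ker
  -- The two-dimensional span meets the hyperplane orthogonal to `u`, so the second minimization has
  -- an admissible vector of quotient at most `Λ`.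
  obtain ⟨s, t, hst, hstW⟩ : ∃ s t : ℝ, (s ≠ 0 ∨ t ≠ 0) ∧ s • y + t • z ∈ W := by
    by_cases h : b u y = 0
    · exact ⟨1, 0, Or.inl one_ne_zero, hmem 1 0, by simpa using h⟩
    · refine ⟨-(b u z), b u y, Or.inr h, hmem _ _, ?_⟩
      change b u (-(b u z) • y + b u y • z) = 0
      simp only [map_add, map_smul, smul_eq_mul]
      ring
  obtain ⟨w, hwW, ν, hbw, hw, hνmin⟩ := exists_rayleigh_minimizer a b has hbs hb W hW
    (fun x hx => ha x hx.1) (fun x hx => hC x hx.1) hcpt hstW (hpos s t hst)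
  refine ⟨u, huK, w, hwW.1, μ, ?_, ν, ?_, hbu, hbw, hWu w hwW, hu, fun h hh => ?_⟩
  · exact le_of_mul_le_mul_right ((hμmin _ (hmem 1 0)).trans (hle 1 0)) hby
  · exact le_of_mul_le_mul_right ((hνmin _ hstW).trans (hle s t)) (hpos s t hst)
  -- The equation for `w` extends from `W` to `K` because both forms vanish on the pair `w`, `u`.
  · have hh' : h - b u h • u ∈ W := by
      refine ⟨K.sub_mem hh (K.smul_mem _ huK), ?_⟩
      change b u (h - b u h • u) = 0
      simp [hbu]
    have h1 := hw _ hh'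
    have h2 : b w u = 0 := by rw [hbs]; exact hWu w hwW
    have h3 : a w u = 0 := by rw [has, hu w hwW.1, hWu w hwW, mul_zero]
    simpa [h2, h3] using h1

end Variational

end MetricGraph

namespace MetricGraph

/-! ### The Sobolev space of the graph and its quadratic forms. -/

section Sobolev

variable {V E : Type*} (G : MetricGraph V E)

/-- Arc length on an edge. -/
noncomputable abbrev edgeMeasure (e : E) : Measure ℝ := volume.restrict (Ioc 0 (G.len e))

/-- Vertex values together with square integrable derivatives on the edges. -/
abbrev SobolevPair : Type _ := (V → ℝ) × (∀ e, Lp ℝ 2 (G.edgeMeasure e))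

variable {G}

/-- The function on the edge `e` that is given by its value at the initial vertex and by its
derivative. -/
noncomputable def SobolevPair.value (k : G.SobolevPair) (e : E) (x : ℝ) : ℝ :=
  k.1 (G.src e) + ∫ y in (0 : ℝ)..x, k.2 e y ∂G.edgeMeasure e

theorem lp_integrable {e : E} (f : Lp ℝ 2 (G.edgeMeasure e)) : Integrable f (G.edgeMeasure e) :=
  (Lp.memLp f).integrable (by norm_num)

theorem lp_intervalIntegrable {e : E} (f : Lp ℝ 2 (G.edgeMeasure e)) (a b : ℝ) :
    IntervalIntegrable f (G.edgeMeasure e) a b :=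
  (lp_integrable f).intervalIntegrable

theorem lp_intervalIntegrable_volume {e : E} (f : Lp ℝ 2 (G.edgeMeasure e)) :
    IntervalIntegrable f volume 0 (G.len e) :=
  (intervalIntegrable_iff_integrableOn_Ioc_of_le (G.len_pos e).le).2 (lp_integrable f)

theorem intervalIntegral_edgeMeasure {e : E} (f : ℝ → ℝ) {x : ℝ} (hx : x ∈ Icc 0 (G.len e)) :
    ∫ y in (0 : ℝ)..x, f y ∂G.edgeMeasure e = ∫ y in (0 : ℝ)..x, f y := by
  rw [intervalIntegral.integral_of_le hx.1, intervalIntegral.integral_of_le hx.1,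
    Measure.restrict_restrict measurableSet_Ioc,
    inter_eq_left.2 (Ioc_subset_Ioc_right hx.2)]

/-- Cauchy–Schwarz against the indicator of `Ioc a b`. This is the source of the Hölder-1/2 estimate
behind the evaluation bounds and the equicontinuity. -/
theorem abs_intervalIntegral_lp_le {e : E} (f : Lp ℝ 2 (G.edgeMeasure e)) {a b : ℝ} (hab : a ≤ b) :
    |∫ y in a..b, f y ∂G.edgeMeasure e| ≤ Real.sqrt (b - a) * ‖f‖ := by
  have hfin : G.edgeMeasure e (Ioc a b) ≠ ⊤ := measure_ne_top _ _
  rw [intervalIntegral.integral_of_le hab,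
    ← L2.inner_indicatorConstLp_one (𝕜 := ℝ) measurableSet_Ioc hfin f, ← Real.norm_eq_abs]
  refine (norm_inner_le_norm _ _).trans (mul_le_mul_of_nonneg_right ?_ (norm_nonneg _))
  rw [norm_indicatorConstLp (by norm_num) (by norm_num), norm_one, one_mul, Real.sqrt_eq_rpow,
    ENNReal.toReal_ofNat]
  refine Real.rpow_le_rpow measureReal_nonneg ?_ (by norm_num)
  rw [Measure.real, Measure.restrict_apply measurableSet_Ioc]
  refine (ENNReal.toReal_mono (by simp) (measure_mono inter_subset_left)).trans ?_
  rw [Real.volume_Ioc, ENNReal.toReal_ofReal (by linarith)]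

theorem value_zero_right (k : G.SobolevPair) (e : E) : k.value e 0 = k.1 (G.src e) := by
  simp [SobolevPair.value]

theorem value_add (k h : G.SobolevPair) (e : E) (x : ℝ) :
    (k + h).value e x = k.value e x + h.value e x := by
  have : ∫ y in (0 : ℝ)..x, (k + h).2 e y ∂G.edgeMeasure e
      = ∫ y in (0 : ℝ)..x, (k.2 e y + h.2 e y) ∂G.edgeMeasure e := by
    refine intervalIntegral.integral_congr_ae ?_
    filter_upwards [Lp.coeFn_add (k.2 e) (h.2 e)] with y hy _
    exact hy
  simp only [SobolevPair.value]
  rw [this, intervalIntegral.integral_add (lp_intervalIntegrable _ _ _)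
    (lp_intervalIntegrable _ _ _)]
  simp only [Prod.fst_add, Pi.add_apply]
  ring

theorem value_smul (c : ℝ) (k : G.SobolevPair) (e : E) (x : ℝ) :
    (c • k).value e x = c * k.value e x := by
  have : ∫ y in (0 : ℝ)..x, (c • k).2 e y ∂G.edgeMeasure e
      = ∫ y in (0 : ℝ)..x, c * k.2 e y ∂G.edgeMeasure e := by
    refine intervalIntegral.integral_congr_ae ?_
    filter_upwards [Lp.coeFn_smul c (k.2 e)] with y hy _
    exact hy
  simp only [SobolevPair.value]
  rw [this, intervalIntegral.integral_const_mul]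
  simp only [Prod.smul_fst, Pi.smul_apply, smul_eq_mul]
  ring

theorem value_sub (k h : G.SobolevPair) (e : E) (x : ℝ) :
    (k - h).value e x = k.value e x - h.value e x := by
  have h1 := value_add (k - h) h e x
  rw [sub_add_cancel] at h1
  linarith

-- Integration against the measure restricted to the edge freezes the primitive outside the edge, so
-- continuity holds on the whole line.
@[fun_prop]
theorem continuous_value (k : G.SobolevPair) (e : E) : Continuous (k.value e) :=
  continuous_const.add
    (intervalIntegral.continuous_primitive (fun a b => lp_intervalIntegrable (k.2 e) a b) 0)

theorem value_sub_value (k : G.SobolevPair) (e : E) (x y : ℝ) :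
    k.value e y - k.value e x = ∫ t in x..y, k.2 e t ∂G.edgeMeasure e := by
  rw [SobolevPair.value, SobolevPair.value, add_sub_add_left_eq_sub,
    intervalIntegral.integral_interval_sub_left] <;> exact lp_intervalIntegrable _ _ _

theorem abs_value_sub_value_le (k : G.SobolevPair) (e : E) (x y : ℝ) :
    |k.value e x - k.value e y| ≤ Real.sqrt |x - y| * ‖k.2 e‖ := by
  rcases le_total x y with h | h
  · rw [abs_sub_comm, value_sub_value, abs_sub_comm x y, abs_of_nonneg (sub_nonneg.2 h)]
    exact abs_intervalIntegral_lp_le _ h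
  · rw [value_sub_value, abs_of_nonneg (sub_nonneg.2 h)]
    exact abs_intervalIntegral_lp_le _ h

variable (G) in
/-- The Sobolev space of continuous functions on `G` with square integrable derivative. -/
noncomputable def sobolevSpace : Submodule ℝ G.SobolevPair where
  carrier := {k | ∀ e, k.value e (G.len e) = k.1 (G.tgt e)}
  add_mem' := fun {k h} hk hh e => by
    rw [value_add, hk e, hh e]; rfl
  zero_mem' := fun e => by
    have := value_smul (0 : ℝ) (0 : G.SobolevPair) e (G.len e)
    rw [zero_smul, zero_mul] at this
    rw [this]; rfl
  smul_mem' := fun c k hk e => by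
    rw [value_smul, hk e]; rfl

theorem mem_sobolevSpace {k : G.SobolevPair} :
    k ∈ G.sobolevSpace ↔ ∀ e, k.value e (G.len e) = k.1 (G.tgt e) := Iff.rfl

variable [Fintype V] [Fintype E]

theorem abs_value_le (k : G.SobolevPair) (e : E) {x : ℝ} (hx : x ∈ Icc 0 (G.len e)) :
    |k.value e x| ≤ (1 + Real.sqrt (G.len e)) * ‖k‖ := by
  have h1 := abs_value_sub_value_le k e x 0
  rw [value_zero_right, sub_zero, abs_of_nonneg hx.1] at h1
  have h2 : |k.1 (G.src e)| ≤ ‖k‖ := (norm_le_pi_norm k.1 (G.src e)).trans (norm_fst_le k)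
  have h3 : ‖k.2 e‖ ≤ ‖k‖ := (norm_le_pi_norm k.2 e).trans (norm_snd_le k)
  have h4 : Real.sqrt x * ‖k.2 e‖ ≤ Real.sqrt (G.len e) * ‖k‖ :=
    mul_le_mul (Real.sqrt_le_sqrt hx.2) h3 (norm_nonneg _) (Real.sqrt_nonneg _)
  have h5 := abs_add_le (k.value e x - k.1 (G.src e)) (k.1 (G.src e))
  rw [sub_add_cancel] at h5
  linarith

/-- Evaluation at the far end of an edge is a bounded functional by `abs_value_le`, so each gluing
condition is closed. -/
theorem isClosed_sobolevSpace : IsClosed (G.sobolevSpace : Set G.SobolevPair) := by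
  have hset : (G.sobolevSpace : Set G.SobolevPair) =
      ⋂ e, {k | k.value e (G.len e) = k.1 (G.tgt e)} := by
    ext k; simp [mem_sobolevSpace]
  rw [hset]
  refine isClosed_iInter fun e => isClosed_eq ?_ (by fun_prop)
  let ev : G.SobolevPair →ₗ[ℝ] ℝ :=
    { toFun := fun k => k.value e (G.len e)
      map_add' := fun k h => value_add k h e _
      map_smul' := fun c k => value_smul c k e _ }
  exact (ev.mkContinuous _ fun k => abs_value_le k e (right_mem_Icc.2 (G.len_pos e).le)).continuous

variable (G) in
/-- The form `∫ u' w'`. -/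
noncomputable def dirichletForm : G.SobolevPair →L[ℝ] G.SobolevPair →L[ℝ] ℝ :=
  LinearMap.mkContinuousOfExistsBound₂
    (LinearMap.mk₂ ℝ (fun k h : G.SobolevPair => ∑ e, inner ℝ (k.2 e) (h.2 e))
      (fun k k' h => by simp [inner_add_left, Finset.sum_add_distrib])
      (fun c k h => by simp [inner_smul_left, Finset.mul_sum])
      (fun k h h' => by simp [inner_add_right, Finset.sum_add_distrib])
      (fun c k h => by simp [inner_smul_right, Finset.mul_sum]))
    ⟨Fintype.card E, fun k h => by
      simp only [LinearMap.mk₂_apply]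
      refine (norm_sum_le _ _).trans ((Finset.sum_le_card_nsmul _ _ (‖k‖ * ‖h‖) fun e _ => ?_).trans ?_)
      · exact (norm_inner_le_norm _ _).trans (mul_le_mul
          ((norm_le_pi_norm k.2 e).trans (norm_snd_le k))
          ((norm_le_pi_norm h.2 e).trans (norm_snd_le h)) (norm_nonneg _) (norm_nonneg _))
      · simp [mul_assoc]⟩

theorem dirichletForm_apply (k h : G.SobolevPair) :
    G.dirichletForm k h = ∑ e, inner ℝ (k.2 e) (h.2 e) := rfl

variable (G) in
/-- The form `∫ p u w` for a continuous weight `p`. -/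
noncomputable def weightForm (p : E → C(ℝ, ℝ)) : G.SobolevPair →L[ℝ] G.SobolevPair →L[ℝ] ℝ :=
  LinearMap.mkContinuousOfExistsBound₂
    (LinearMap.mk₂ ℝ
      (fun k h : G.SobolevPair => ∑ e, ∫ x in (0 : ℝ)..G.len e, p e x * (k.value e x * h.value e x))
      (fun k k' h => by
        rw [← Finset.sum_add_distrib]
        refine Finset.sum_congr rfl fun e _ => ?_
        rw [← intervalIntegral.integral_add (Continuous.intervalIntegrable (by fun_prop) _ _)
          (Continuous.intervalIntegrable (by fun_prop) _ _)]
        simp only [value_add]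
        congr 1; ext x; ring)
      (fun c k h => by
        rw [smul_eq_mul, Finset.mul_sum]
        refine Finset.sum_congr rfl fun e _ => ?_
        rw [← intervalIntegral.integral_const_mul]
        simp only [value_smul]
        congr 1; ext x; ring)
      (fun k h h' => by
        rw [← Finset.sum_add_distrib]
        refine Finset.sum_congr rfl fun e _ => ?_
        rw [← intervalIntegral.integral_add (Continuous.intervalIntegrable (by fun_prop) _ _)
          (Continuous.intervalIntegrable (by fun_prop) _ _)]
        simp only [value_add]
        congr 1; ext x; ring)
      (fun c k h => by
        rw [smul_eq_mul, Finset.mul_sum]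
        refine Finset.sum_congr rfl fun e _ => ?_
        rw [← intervalIntegral.integral_const_mul]
        simp only [value_smul]
        congr 1; ext x; ring))
    (by
      have hb : ∀ e, ∃ C, ∀ x ∈ Icc 0 (G.len e), ‖p e x‖ ≤ C := fun e =>
        isCompact_Icc.exists_bound_of_continuousOn (p e).continuous.continuousOn
      choose C hC using hb
      refine ⟨∑ e, C e * (1 + Real.sqrt (G.len e)) ^ 2 * G.len e, fun k h => ?_⟩
      simp only [LinearMap.mk₂_apply]
      rw [Finset.sum_mul, Finset.sum_mul]
      refine (norm_sum_le _ _).trans (Finset.sum_le_sum fun e _ => ?_)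
      have h0 := (G.len_pos e).le
      have := intervalIntegral.norm_integral_le_of_norm_le_const (a := 0) (b := G.len e)
        (f := fun x => p e x * (k.value e x * h.value e x))
        (C := C e * (((1 + Real.sqrt (G.len e)) * ‖k‖) * ((1 + Real.sqrt (G.len e)) * ‖h‖)))
        (fun x hx => by
          rw [uIoc_of_le h0] at hx
          have hx' : x ∈ Icc 0 (G.len e) := Ioc_subset_Icc_self hx
          rw [norm_mul, norm_mul]
          refine mul_le_mul (hC e x hx') (mul_le_mul (abs_value_le k e hx') (abs_value_le h e hx')
            (norm_nonneg _) (by positivity)) (by positivity)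
            ((norm_nonneg _).trans (hC e x hx')))
      rw [sub_zero, abs_of_nonneg h0] at this
      refine this.trans (le_of_eq ?_)
      ring)

theorem weightForm_apply (p : E → C(ℝ, ℝ)) (k h : G.SobolevPair) :
    G.weightForm p k h = ∑ e, ∫ x in (0 : ℝ)..G.len e, p e x * (k.value e x * h.value e x) := rfl

theorem dirichletForm_comm (k h : G.SobolevPair) : G.dirichletForm k h = G.dirichletForm h k := by
  simp only [dirichletForm_apply]
  exact Finset.sum_congr rfl fun e _ => real_inner_comm _ _

theorem weightForm_comm (p : E → C(ℝ, ℝ)) (k h : G.SobolevPair) :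
    G.weightForm p k h = G.weightForm p h k := by
  simp only [weightForm_apply]
  refine Finset.sum_congr rfl fun e _ => ?_
  congr 1; ext x; ring

theorem dirichletForm_self_nonneg (k : G.SobolevPair) : 0 ≤ G.dirichletForm k k :=
  Finset.sum_nonneg fun _ _ => real_inner_self_nonneg

theorem weightForm_mono {p r : E → C(ℝ, ℝ)} (h : ∀ e, ∀ x ∈ Icc 0 (G.len e), p e x ≤ r e x)
    (k : G.SobolevPair) : G.weightForm p k k ≤ G.weightForm r k k := by
  simp only [weightForm_apply]
  refine Finset.sum_le_sum fun e _ => intervalIntegral.integral_mono_on (G.len_pos e).le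
    (Continuous.intervalIntegrable (by fun_prop) _ _)
    (Continuous.intervalIntegrable (by fun_prop) _ _) fun x hx =>
      mul_le_mul_of_nonneg_right (h e x hx) (mul_self_nonneg _)

theorem weightForm_self_nonneg {p : E → C(ℝ, ℝ)} (h : ∀ e, ∀ x ∈ Icc 0 (G.len e), 0 ≤ p e x)
    (k : G.SobolevPair) : 0 ≤ G.weightForm p k k := by
  refine Finset.sum_nonneg fun e _ => intervalIntegral.integral_nonneg (G.len_pos e).le
    fun x hx => mul_nonneg (h e x hx) (mul_self_nonneg _)

theorem weightForm_smul (c : ℝ) (p : E → C(ℝ, ℝ)) (k h : G.SobolevPair) :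
    G.weightForm (c • p) k h = c * G.weightForm p k h := by
  simp only [weightForm_apply, Finset.mul_sum]
  refine Finset.sum_congr rfl fun e _ => ?_
  rw [← intervalIntegral.integral_const_mul]
  congr 1; ext x
  simp [mul_assoc]

end Sobolev

end MetricGraph

namespace MetricGraph

/-! ### Integration by parts, coercivity and compactness. -/

section Sobolev

open Filter Topology

variable {V E : Type*} {G : MetricGraph V E}

/-- Integration by parts against a continuously differentiable function. -/
theorem inner_add_integral_mul_value (h : G.SobolevPair) (e : E) {F g : ℝ → ℝ}
    (hg : Continuous g) (hF : ∀ x, HasDerivAt F (g x) x) {f : Lp ℝ 2 (G.edgeMeasure e)}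
    (hf : f =ᵐ[G.edgeMeasure e] F) :
    inner ℝ f (h.2 e) + ∫ x in (0 : ℝ)..G.len e, g x * h.value e x
      = F (G.len e) * h.value e (G.len e) - F 0 * h.1 (G.src e) := by
  have hl := (G.len_pos e).le
  have hFc : Continuous F := continuous_iff_continuousAt.2 fun x => (hF x).continuousAt
  have hint := lp_intervalIntegrable_volume (h.2 e)
  set H : ℝ → ℝ := fun x => ∫ y in (0 : ℝ)..x, h.2 e y with hH
  have hval : ∀ x ∈ Icc 0 (G.len e), h.value e x = h.1 (G.src e) + H x := fun x hx => by
    rw [SobolevPair.value, intervalIntegral_edgeMeasure _ hx]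
  -- `H` is only a primitive of an `L²` function, so the product rule is applied in its absolutely
  -- continuous form.
  have hHac : AbsolutelyContinuousOnInterval H 0 (G.len e) :=
    hint.absolutelyContinuousOnInterval_intervalIntegral left_mem_uIcc
  have hFd : deriv F = g := funext fun x => (hF x).deriv
  have hFac : AbsolutelyContinuousOnInterval F 0 (G.len e) := by
    refine ContDiffOn.absolutelyContinuousOnInterval (ContDiff.contDiffOn ?_)
    exact contDiff_one_iff_deriv.2 ⟨fun x => (hF x).differentiableAt, hFd ▸ hg⟩
  have hparts := hFac.integral_deriv_mul_eq_sub hHac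
  have hinner : inner ℝ f (h.2 e) = ∫ x in (0 : ℝ)..G.len e, F x * h.2 e x := by
    rw [L2.inner_def, intervalIntegral.integral_of_le hl]
    refine integral_congr_ae ?_
    filter_upwards [hf] with x hx
    rw [hx]
    exact mul_comm _ _
  have hcongr : ∫ x in (0 : ℝ)..G.len e, deriv F x * H x + F x * deriv H x
      = ∫ x in (0 : ℝ)..G.len e, (g x * H x + F x * h.2 e x) := by
    refine intervalIntegral.integral_congr_ae ?_
    filter_upwards [hint.ae_hasDerivAt_integral] with x hx hx'
    rw [hFd, (hx (uIoc_subset_uIcc hx') 0 left_mem_uIcc).deriv]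
  have hgH : IntervalIntegrable (fun x => g x * H x) volume 0 (G.len e) :=
    (hg.continuousOn.mul hHac.continuousOn).intervalIntegrable
  have hFh : IntervalIntegrable (fun x => F x * h.2 e x) volume 0 (G.len e) :=
    hint.continuousOn_mul hFc.continuousOn
  have hgv : ∫ x in (0 : ℝ)..G.len e, g x * h.value e x
      = h.1 (G.src e) * (F (G.len e) - F 0) + ∫ x in (0 : ℝ)..G.len e, g x * H x := by
    rw [← intervalIntegral.integral_eq_sub_of_hasDerivAt (fun x _ => hF x)
      (hg.intervalIntegrable _ _), ← intervalIntegral.integral_const_mul,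
      ← intervalIntegral.integral_add ((hg.intervalIntegrable _ _).const_mul _) hgH]
    refine intervalIntegral.integral_congr fun x hx => ?_
    rw [uIcc_of_le hl] at hx
    simp only [hval x hx]
    ring
  have hH0 : H 0 = 0 := by simp [hH]
  rw [hcongr, intervalIntegral.integral_add hgH hFh, hH0] at hparts
  rw [hinner, hgv, hval _ (right_mem_Icc.2 hl)]
  linarith

variable [Fintype V] [Fintype E]

variable (G) in
/-- The form `∫ u w`. -/
noncomputable abbrev massForm : G.SobolevPair →L[ℝ] G.SobolevPair →L[ℝ] ℝ :=
  G.weightForm fun _ => 1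

theorem massForm_self_nonneg (k : G.SobolevPair) : 0 ≤ G.massForm k k :=
  weightForm_self_nonneg (fun _ _ _ => zero_le_one) k

/-- The value at a point of an edge is compared with the value at every other point, at a cost of
`len e` times the energy, and the comparison is averaged over the edge. The hypothesis `hinc`
excludes isolated vertices, whose values the forms do not see. -/
theorem norm_sq_le_dirichletForm_add_massForm (hinc : ∀ v, ∃ e, G.src e = v ∨ G.tgt e = v)
    {k : G.SobolevPair} (hk : k ∈ G.sobolevSpace) :
    ‖k‖ ^ 2 ≤ (1 + ∑ e, (2 / G.len e + 2 * G.len e)) *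
      (G.dirichletForm k k + G.massForm k k) := by
  set D := G.dirichletForm k k with hD
  set B := G.massForm k k with hB
  have hD0 : 0 ≤ D := dirichletForm_self_nonneg k
  have hB0 : 0 ≤ B := massForm_self_nonneg k
  have hCe : ∀ e, 0 ≤ 2 / G.len e + 2 * G.len e := fun e => by
    have := G.len_pos e; positivity
  have hC0 : 0 ≤ ∑ e, (2 / G.len e + 2 * G.len e) := Finset.sum_nonneg fun e _ => hCe e
  have hfD : ∀ e, ‖k.2 e‖ ^ 2 ≤ D := fun e => by
    rw [← real_inner_self_eq_norm_sq]
    exact Finset.single_le_sum (f := fun e => inner ℝ (k.2 e) (k.2 e))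
      (fun e _ => real_inner_self_nonneg) (Finset.mem_univ e)
  have hvB : ∀ e, ∫ x in (0 : ℝ)..G.len e, k.value e x ^ 2 ≤ B := fun e => by
    have := Finset.single_le_sum
      (f := fun e => ∫ x in (0 : ℝ)..G.len e, (1 : C(ℝ, ℝ)) x * (k.value e x * k.value e x))
      (fun e _ => intervalIntegral.integral_nonneg (G.len_pos e).le
        fun x _ => mul_nonneg zero_le_one (mul_self_nonneg _)) (Finset.mem_univ e)
    refine le_trans (le_of_eq ?_) this
    congr 1; ext x; simp [sq]
  have hend : ∀ e, ∀ x₀ ∈ Icc 0 (G.len e),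
      k.value e x₀ ^ 2 ≤ (2 / G.len e + 2 * G.len e) * (D + B) := fun e x₀ hx₀ => by
    have hl := G.len_pos e
    have hpt : ∀ x ∈ Icc 0 (G.len e),
        k.value e x₀ ^ 2 ≤ 2 * k.value e x ^ 2 + 2 * (G.len e * D) := fun x hx => by
      have h1 := abs_value_sub_value_le k e x₀ x
      have h2 : (k.value e x₀ - k.value e x) ^ 2 ≤ G.len e * D := by
        rw [← sq_abs]
        refine (pow_le_pow_left₀ (abs_nonneg _) h1 2).trans ?_
        rw [mul_pow, Real.sq_sqrt (abs_nonneg _)]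
        refine mul_le_mul ?_ (hfD e) (by positivity) hl.le
        rw [abs_le]
        constructor <;> linarith [hx.1, hx.2, hx₀.1, hx₀.2]
      nlinarith [sq_nonneg (k.value e x₀ - 2 * k.value e x)]
    have hint := intervalIntegral.integral_mono_on (μ := volume) hl.le
      (continuous_const.intervalIntegrable 0 (G.len e))
      (Continuous.intervalIntegrable (by fun_prop) _ _) hpt
    rw [intervalIntegral.integral_const, intervalIntegral.integral_add
      (Continuous.intervalIntegrable (by fun_prop) _ _)
      (continuous_const.intervalIntegrable _ _), intervalIntegral.integral_const,
      intervalIntegral.integral_const_mul, sub_zero, smul_eq_mul, smul_eq_mul] at hint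
    have h3 : G.len e * k.value e x₀ ^ 2 ≤ 2 * B + G.len e * (2 * (G.len e * D)) := by
      linarith [hvB e]
    have h4 : G.len e * ((2 / G.len e + 2 * G.len e) * (D + B))
        = 2 * B + G.len e * (2 * (G.len e * D)) + (2 * D + 2 * G.len e ^ 2 * B) := by
      field_simp
      ring
    have h5 : 0 ≤ 2 * D + 2 * G.len e ^ 2 * B := by positivity
    exact le_of_mul_le_mul_left (by linarith) hl
  have hsum : ∀ e, 2 / G.len e + 2 * G.len e ≤ 1 + ∑ e, (2 / G.len e + 2 * G.len e) := fun e => by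
    have := Finset.single_le_sum (f := fun e => 2 / G.len e + 2 * G.len e)
      (fun e _ => hCe e) (Finset.mem_univ e)
    linarith
  have hDB : 0 ≤ D + B := by linarith
  have hnorm : ‖k‖ ≤ Real.sqrt ((1 + ∑ e, (2 / G.len e + 2 * G.len e)) * (D + B)) := by
    rw [norm_prod_le_iff, pi_norm_le_iff_of_nonneg (Real.sqrt_nonneg _),
      pi_norm_le_iff_of_nonneg (Real.sqrt_nonneg _)]
    constructor
    · intro v
      obtain ⟨e, he⟩ := hinc v
      have h1 : k.1 v ^ 2 ≤ (2 / G.len e + 2 * G.len e) * (D + B) := by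
        rcases he with rfl | rfl
        · have := hend e 0 (left_mem_Icc.2 (G.len_pos e).le)
          rwa [value_zero_right] at this
        · have := hend e _ (right_mem_Icc.2 (G.len_pos e).le)
          rwa [hk e] at this
      refine Real.le_sqrt_of_sq_le ?_
      rw [Real.norm_eq_abs, sq_abs]
      exact h1.trans (mul_le_mul_of_nonneg_right (hsum e) hDB)
    · intro e
      refine Real.le_sqrt_of_sq_le ((hfD e).trans ?_)
      have : 0 ≤ (∑ e, (2 / G.len e + 2 * G.len e)) * (D + B) := mul_nonneg hC0 hDB
      linarith
  refine (pow_le_pow_left₀ (norm_nonneg _) hnorm 2).trans (le_of_eq (Real.sq_sqrt ?_))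
  exact mul_nonneg (by linarith) hDB

/-- Bounded sequences in the Sobolev space have subsequences that are Cauchy in `L²`. -/
theorem exists_subseq_massForm_cauchy (k : ℕ → G.SobolevPair) (R : ℝ) (hR : ∀ n, ‖k n‖ ≤ R) :
    ∃ φ : ℕ → ℕ, StrictMono φ ∧ ∀ ε > 0, ∃ N, ∀ m ≥ N, ∀ n ≥ N,
      G.massForm (k (φ m) - k (φ n)) (k (φ m) - k (φ n)) < ε := by
  -- The disjoint union of the closed edges is one compact space, so Arzelà–Ascoli is applied once.
  let Z := Σ e, Icc (0 : ℝ) (G.len e)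
  have hcont : ∀ h : G.SobolevPair, Continuous fun z : Z => h.value z.1 z.2 := fun h =>
    continuous_sigma fun e => (continuous_value h e).comp continuous_subtype_val
  let T : G.SobolevPair → BoundedContinuousFunction Z ℝ := fun h =>
    BoundedContinuousFunction.mkOfCompact ⟨_, hcont h⟩
  have hT : ∀ h z, T h z = h.value z.1 z.2 := fun _ _ => rfl
  have hR0 : 0 ≤ R := (norm_nonneg _).trans (hR 0)
  set C := ∑ e, (1 + Real.sqrt (G.len e)) with hC
  have hCe : ∀ e, 1 + Real.sqrt (G.len e) ≤ C := fun e =>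
    Finset.single_le_sum (f := fun e => 1 + Real.sqrt (G.len e))
      (fun e _ => by positivity) (Finset.mem_univ e)
  have hcpt : IsCompact (closure (range fun n => T (k n))) := by
    refine BoundedContinuousFunction.arzela_ascoli (Icc (-(C * R)) (C * R)) isCompact_Icc _ ?_ ?_
    · rintro _ z ⟨n, rfl⟩
      rw [mem_Icc, ← abs_le, hT]
      exact (abs_value_le (k n) z.1 z.2.2).trans
        (mul_le_mul (hCe z.1) (hR n) (norm_nonneg _) (by positivity))
    · rintro ⟨e, x⟩
      refine fun U hU => ?_
      rw [Sigma.nhds_mk, eventually_map]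
      have hmod : Tendsto (fun y : Icc (0 : ℝ) (G.len e) => Real.sqrt |(x : ℝ) - y| * R) (𝓝 x)
          (𝓝 0) := by
        have : Continuous fun y : Icc (0 : ℝ) (G.len e) => Real.sqrt |(x : ℝ) - y| * R := by
          fun_prop
        simpa using this.tendsto x
      have heq : EquicontinuousAt (fun (f : range fun n => T (k n)) (y : Icc (0 : ℝ) (G.len e)) =>
          (f : BoundedContinuousFunction Z ℝ) ⟨e, y⟩) x := by
        refine Metric.equicontinuousAt_of_continuity_modulus _ hmod _ (Eventually.of_forall ?_)
        rintro y ⟨_, n, rfl⟩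
        rw [Real.dist_eq]
        refine (abs_value_sub_value_le (k n) e x y).trans
          (mul_le_mul_of_nonneg_left ?_ (Real.sqrt_nonneg _))
        exact ((norm_le_pi_norm (k n).2 e).trans (norm_snd_le (k n))).trans (hR n)
      exact heq U hU
  obtain ⟨f, -, φ, hφ, hf⟩ := hcpt.tendsto_subseq fun n => subset_closure (mem_range_self n)
  refine ⟨φ, hφ, fun ε hε => ?_⟩
  have hcau := hf.cauchySeq
  rw [Metric.cauchySeq_iff] at hcau
  have hL0 : 0 ≤ ∑ e, G.len e := Finset.sum_nonneg fun e _ => (G.len_pos e).le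
  -- Uniform distance at most `η` gives mass at most `η ^ 2` times the total length; the added `1`
  -- makes this strictly less than `ε`.
  set η := Real.sqrt (ε / (∑ e, G.len e + 1)) with hη
  have hη0 : 0 < η := Real.sqrt_pos.2 (by positivity)
  have hη2 : η ^ 2 = ε / (∑ e, G.len e + 1) := Real.sq_sqrt (by positivity)
  obtain ⟨N, hN⟩ := hcau η hη0
  refine ⟨N, fun m hm n hn => ?_⟩
  have hdist := (hN m hm n hn).le
  have hpt : ∀ e, ∀ x ∈ Icc 0 (G.len e), (k (φ m) - k (φ n)).value e x ^ 2 ≤ η ^ 2 :=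
    fun e x hx => by
      have h1 := (BoundedContinuousFunction.dist_coe_le_dist (f := T (k (φ m)))
        (g := T (k (φ n))) ⟨e, ⟨x, hx⟩⟩).trans hdist
      rw [Real.dist_eq, hT, hT] at h1
      rw [value_sub, ← sq_abs]
      exact pow_le_pow_left₀ (abs_nonneg _) h1 2
  have hbound : G.massForm (k (φ m) - k (φ n)) (k (φ m) - k (φ n)) ≤ ∑ e, G.len e * η ^ 2 := by
    rw [weightForm_apply]
    refine Finset.sum_le_sum fun e _ => ?_
    have := intervalIntegral.integral_mono_on (μ := volume) (G.len_pos e).le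
      (Continuous.intervalIntegrable (by fun_prop) _ _)
      (continuous_const.intervalIntegrable 0 (G.len e)) (hpt e)
    rw [intervalIntegral.integral_const, sub_zero, smul_eq_mul] at this
    refine le_trans (le_of_eq ?_) this
    congr 1; ext x; simp [sq]
  refine hbound.trans_lt ?_
  rw [← Finset.sum_mul, hη2, mul_div_assoc', div_lt_iff₀ (by positivity)]
  linarith

end Sobolev

end MetricGraph

namespace MetricGraph

/-! ### Equivalence of weak and strong eigenfunctions. -/

section WeakStrong

variable {V E : Type*} {G : MetricGraph V E}

theorem pt_of_mem_Ioo {e : E} {x : ℝ} (hx : x ∈ Ioo 0 (G.len e)) :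
    G.pt e x = Point.interior e x hx := dif_pos hx

theorem pt_of_nonpos (e : E) {x : ℝ} (hx : x ≤ 0) : G.pt e x = Point.vertex (G.src e) := by
  rw [pt, dif_neg fun h => absurd h.1 (not_lt.2 hx), if_pos hx]

theorem pt_of_len_le (e : E) {x : ℝ} (hx : G.len e ≤ x) : G.pt e x = Point.vertex (G.tgt e) := by
  rw [pt, dif_neg fun h => absurd h.2 (not_lt.2 hx),
    if_neg (not_le.2 ((G.len_pos e).trans_le hx))]

theorem eq_zero_or_len_or_mem_Ioo {e : E} {x : ℝ} (hx : x ∈ Icc 0 (G.len e)) :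
    x = 0 ∨ x = G.len e ∨ x ∈ Ioo 0 (G.len e) := by
  rcases hx.1.eq_or_lt with h | h
  · exact Or.inl h.symm
  · rcases hx.2.eq_or_lt with h' | h'
    · exact Or.inr (Or.inl h')
    · exact Or.inr (Or.inr ⟨h, h'⟩)

/-- The function on `G` that is given by a pair. -/
noncomputable def SobolevPair.toFun (k : G.SobolevPair) : G.Point → ℝ
  | Point.vertex v => k.1 v
  | Point.interior e x _ => k.value e x

theorem toFun_pt {k : G.SobolevPair} (hk : k ∈ G.sobolevSpace) {e : E} {x : ℝ}
    (hx : x ∈ Icc 0 (G.len e)) : k.toFun (G.pt e x) = k.value e x := by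
  rcases eq_zero_or_len_or_mem_Ioo hx with rfl | rfl | h
  · rw [pt_of_nonpos e le_rfl, value_zero_right]; rfl
  · rw [pt_of_len_le e le_rfl, hk e]; rfl
  · rw [pt_of_mem_Ioo h]; rfl

theorem toFun_add (k h : G.SobolevPair) : (k + h).toFun = k.toFun + h.toFun := by
  ext (v | ⟨e, x, hx⟩)
  · rfl
  · exact value_add k h e x

theorem toFun_smul (c : ℝ) (k : G.SobolevPair) : (c • k).toFun = c • k.toFun := by
  ext (v | ⟨e, x, hx⟩)
  · rfl
  · exact value_smul c k e x

theorem memLp_edgeMeasure {F : ℝ → ℝ} (hF : Continuous F) (e : E) :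
    MemLp F 2 (G.edgeMeasure e) := by
  obtain ⟨C, hC⟩ := (isCompact_Icc (a := 0) (b := G.len e)).exists_bound_of_continuousOn
    hF.continuousOn
  exact MemLp.of_bound hF.aestronglyMeasurable C
    (ae_restrict_of_forall_mem measurableSet_Ioc fun x hx => hC x (Ioc_subset_Icc_self hx))

theorem value_eq_of_ae_eq {k : G.SobolevPair} {e : E} {F : ℝ → ℝ}
    (hF : k.2 e =ᵐ[G.edgeMeasure e] F) {x : ℝ} (hx : x ∈ Icc 0 (G.len e)) :
    k.value e x = k.1 (G.src e) + ∫ y in (0 : ℝ)..x, F y := by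
  rw [SobolevPair.value, ← intervalIntegral_edgeMeasure _ hx]
  congr 1
  refine intervalIntegral.integral_congr_ae ?_
  filter_upwards [hF] with y hy _ using hy

variable [Fintype V] [Fintype E]

theorem dirichletForm_add_weightForm_sub (p : E → C(ℝ, ℝ)) (ν : ℝ) (k h : G.SobolevPair) :
    G.dirichletForm k h + G.weightForm p k h - ν * G.massForm k h =
      ∑ e, (inner ℝ (k.2 e) (h.2 e) +
        ∫ x in (0 : ℝ)..G.len e, (p e x - ν) * k.value e x * h.value e x) := by
  rw [dirichletForm_apply, weightForm_apply, weightForm_apply, Finset.mul_sum,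
    ← Finset.sum_add_distrib, ← Finset.sum_sub_distrib]
  refine Finset.sum_congr rfl fun e _ => ?_
  rw [add_sub_assoc, ← intervalIntegral.integral_const_mul, ← intervalIntegral.integral_sub
    (Continuous.intervalIntegrable (by fun_prop) _ _)
    (Continuous.intervalIntegrable (by fun_prop) _ _)]
  congr 2
  ext x
  simp only [ContinuousMap.one_apply]
  ring

variable [DecidableEq V]

/-- Turns the boundary terms of edgewise integration by parts into Kirchhoff sums, each weighted by
the vertex value of the test function. -/
theorem sum_edges_eq_sum_vertices (A B : E → ℝ) (c : V → ℝ) :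
    ∑ e, (A e * c (G.tgt e) - B e * c (G.src e)) =
      -∑ v, c v * ((∑ e with G.src e = v, B e) - ∑ e with G.tgt e = v, A e) := by
  have h : ∀ (f : E → V) (A : E → ℝ),
      ∑ e, A e * c (f e) = ∑ v, c v * ∑ e with f e = v, A e := fun f A => by
    rw [← Finset.sum_fiberwise (Finset.univ : Finset E) f]
    refine Finset.sum_congr rfl fun v _ => ?_
    rw [Finset.mul_sum]
    refine Finset.sum_congr rfl fun e he => ?_
    rw [(Finset.mem_filter.1 he).2, mul_comm]
  rw [Finset.sum_sub_distrib, h, h, ← Finset.sum_sub_distrib, ← Finset.sum_neg_distrib]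
  refine Finset.sum_congr rfl fun v _ => ?_
  ring

/-- Eigenfunctions are weak eigenfunctions. -/
theorem IsEigenfunction.exists_weak {q : G.Point → ℝ} {p : E → C(ℝ, ℝ)}
    (hqp : ∀ e, ∀ x ∈ Icc 0 (G.len e), q (G.pt e x) = p e x) {ν : ℝ} {u : G.Point → ℝ}
    (hu : G.IsEigenfunction q ν u) :
    ∃ k ∈ G.sobolevSpace, k.toFun = u ∧
      ∀ h ∈ G.sobolevSpace, G.dirichletForm k h + G.weightForm p k h = ν * G.massForm k h := by
  obtain ⟨-, du, ddu, hdom, heq⟩ := hu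
  -- `pt` sends coordinates beyond the ends to the end vertices, so `u` along an edge is the
  -- constant extension of its restriction to the closed edge.
  have hUc : ∀ e, Continuous fun x => u (G.pt e x) := fun e => by
    have hl := (G.len_pos e).le
    have h1 : ContinuousOn (fun x => u (G.pt e x)) (Icc 0 (G.len e)) := fun x hx =>
      (hdom.hasDeriv e x hx).continuousWithinAt
    have h2 : (fun x => u (G.pt e x)) = IccExtend hl ((Icc 0 (G.len e)).domRestrict
        fun x => u (G.pt e x)) := by
      ext x
      rcases le_total x 0 with hx | hx
      · rw [IccExtend_of_le_left _ _ hx, domRestrict_apply, pt_of_nonpos e hx,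
          pt_of_nonpos e le_rfl]
      · rcases le_total (G.len e) x with hx' | hx'
        · rw [IccExtend_of_right_le _ _ hx', domRestrict_apply, pt_of_len_le e hx',
            pt_of_len_le e le_rfl]
        · rw [IccExtend_of_mem _ _ ⟨hx, hx'⟩, domRestrict_apply]
    rw [h2]
    exact h1.domRestrict.Icc_extend'
  set g : E → ℝ → ℝ := fun e x => (p e x - ν) * u (G.pt e x) with hg
  have hgc : ∀ e, Continuous (g e) := fun e =>
    ((p e).continuous.sub continuous_const).mul (hUc e)
  -- The equation identifies `ddu` almost everywhere with the continuous `g`, so on the edge `du`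
  -- agrees with the continuously differentiable `F`.
  set F : E → ℝ → ℝ := fun e x => du e 0 + ∫ y in (0 : ℝ)..x, g e y with hFdef
  have hF : ∀ e x, HasDerivAt (F e) (g e x) x := fun e x =>
    (((hgc e).integral_hasStrictDerivAt 0 x).hasDerivAt).const_add _
  have hFc : ∀ e, Continuous (F e) := fun e =>
    continuous_iff_continuousAt.2 fun x => (hF e x).continuousAt
  have hdu : ∀ e, ∀ x ∈ Icc 0 (G.len e), du e x = F e x := fun e x hx => by
    rw [hdom.primitive e x hx]
    simp only [hFdef]
    congr 1
    rw [intervalIntegral.integral_of_le hx.1, intervalIntegral.integral_of_le hx.1,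
      integral_Ioc_eq_integral_Ioo, integral_Ioc_eq_integral_Ioo]
    refine integral_congr_ae ?_
    have hsub : Ioo 0 x ⊆ Ioo 0 (G.len e) := Ioo_subset_Ioo_right hx.2
    filter_upwards [ae_restrict_of_ae_restrict_of_subset hsub (heq e),
      ae_restrict_mem measurableSet_Ioo] with y hy hy'
    rw [hqp e y (Ioo_subset_Icc_self (hsub hy'))] at hy
    simp only [hg]
    linarith
  let k : G.SobolevPair :=
    (fun v => u (Point.vertex v), fun e => (memLp_edgeMeasure (hFc e) e).toLp (F e))
  have hk2 : ∀ e, k.2 e =ᵐ[G.edgeMeasure e] F e := fun e =>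
    (memLp_edgeMeasure (hFc e) e).coeFn_toLp
  have hval : ∀ e, ∀ x ∈ Icc 0 (G.len e), k.value e x = u (G.pt e x) := fun e x hx => by
    rw [value_eq_of_ae_eq (hk2 e) hx]
    have h1 := intervalIntegral.integral_eq_sub_of_hasDerivAt_of_le (f := fun y => u (G.pt e y))
      (f' := F e) hx.1 (hUc e).continuousOn (fun y hy => by
        have hy' : y ∈ Icc 0 (G.len e) := ⟨hy.1.le, hy.2.le.trans hx.2⟩
        rw [← hdu e y hy']
        exact (hdom.hasDeriv e y hy').hasDerivAt (Icc_mem_nhds hy.1 (hy.2.trans_le hx.2)))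
      ((hFc e).intervalIntegrable _ _)
    rw [h1, pt_of_nonpos e le_rfl]
    change u (Point.vertex (G.src e)) + _ = _
    ring
  have hkK : k ∈ G.sobolevSpace := fun e => by
    rw [hval e _ (right_mem_Icc.2 (G.len_pos e).le), pt_of_len_le e le_rfl]
  refine ⟨k, hkK, ?_, fun h hh => ?_⟩
  · ext (v | ⟨e, x, hx⟩)
    · rfl
    · rw [← pt_of_mem_Ioo hx, toFun_pt hkK (Ioo_subset_Icc_self hx),
        hval e x (Ioo_subset_Icc_self hx)]
  · rw [← sub_eq_zero, dirichletForm_add_weightForm_sub]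
    have hedge : ∀ e, inner ℝ (k.2 e) (h.2 e) +
        ∫ x in (0 : ℝ)..G.len e, (p e x - ν) * k.value e x * h.value e x
        = du e (G.len e) * h.1 (G.tgt e) - du e 0 * h.1 (G.src e) := fun e => by
      have hl := (G.len_pos e).le
      have h1 := inner_add_integral_mul_value h e (hgc e) (hF e) (hk2 e)
      rw [hh e, ← hdu e _ (right_mem_Icc.2 hl), ← hdu e _ (left_mem_Icc.2 hl)] at h1
      rw [← h1]
      congr 1
      refine intervalIntegral.integral_congr fun x hx => ?_
      rw [uIcc_of_le hl] at hx
      simp only [hval e x hx, hg]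
    rw [Finset.sum_congr rfl fun e _ => hedge e, sum_edges_eq_sum_vertices]
    simp [hdom.kirchhoff]

/-- Weak eigenfunctions are eigenfunctions. -/
theorem isEigenfunction_of_weak {q : G.Point → ℝ} {p : E → C(ℝ, ℝ)}
    (hqp : ∀ e, ∀ x ∈ Icc 0 (G.len e), q (G.pt e x) = p e x) {ν : ℝ} {k : G.SobolevPair}
    (hk : k ∈ G.sobolevSpace) (hk0 : k.toFun ≠ 0)
    (hweak : ∀ h ∈ G.sobolevSpace,
      G.dirichletForm k h + G.weightForm p k h = ν * G.massForm k h) :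
    G.IsEigenfunction q ν k.toFun := by
  classical
  set g : E → ℝ → ℝ := fun e x => (p e x - ν) * k.value e x with hg
  have hgc : ∀ e, Continuous (g e) := fun e => by fun_prop
  have hweak' : ∀ h ∈ G.sobolevSpace, ∑ e, (inner ℝ (k.2 e) (h.2 e) +
      ∫ x in (0 : ℝ)..G.len e, g e x * h.value e x) = 0 := fun h hh => by
    rw [← dirichletForm_add_weightForm_sub, hweak h hh, sub_self]
  set P : E → ℝ → ℝ := fun e x => ∫ y in (0 : ℝ)..x, g e y with hPdef
  have hP : ∀ e x, HasDerivAt (P e) (g e x) x := fun e x =>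
    ((hgc e).integral_hasStrictDerivAt 0 x).hasDerivAt
  have hPc : ∀ e, Continuous (P e) := fun e =>
    continuous_iff_continuousAt.2 fun x => (hP e x).continuousAt
  -- Du Bois-Reymond argument: the weak equation is tested with a function supported on `e`,
  -- vanishing at all vertices, whose derivative is the difference `r` that is to be shown zero. The
  -- result is `⟪r, r⟫ = 0`.
  have hreg : ∀ e, ∃ κ : ℝ, k.2 e =ᵐ[G.edgeMeasure e] fun x => κ + P e x := fun e => by
    have hl := G.len_pos e
    set Pl := (memLp_edgeMeasure (G := G) (hPc e) e).toLp (P e) with hPl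
    have hPl' : Pl =ᵐ[G.edgeMeasure e] P e := (memLp_edgeMeasure (hPc e) e).coeFn_toLp
    -- The mean is subtracted so that `r` integrates to zero and the test function returns to `0` at
    -- the far end.
    set κ := (∫ x in (0 : ℝ)..G.len e, (k.2 e - Pl) x ∂G.edgeMeasure e) / G.len e with hκ
    set cl := (memLp_edgeMeasure (G := G) (continuous_const (y := κ)) e).toLp (fun _ => κ) with hcl
    have hcl' : cl =ᵐ[G.edgeMeasure e] fun _ => κ :=
      (memLp_edgeMeasure continuous_const e).coeFn_toLp
    set r := k.2 e - Pl - cl with hr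
    let t : G.SobolevPair := (0, Pi.single e r)
    have ht2 : t.2 e = r := by simp [t]
    have hte : t.value e (G.len e) = 0 := by
      have h1 : ∫ x in (0 : ℝ)..G.len e, r x ∂G.edgeMeasure e
          = ∫ x in (0 : ℝ)..G.len e, ((k.2 e - Pl) x - κ) ∂G.edgeMeasure e := by
        refine intervalIntegral.integral_congr_ae ?_
        filter_upwards [Lp.coeFn_sub (k.2 e - Pl) cl, hcl'] with x h1 h2 _
        rw [hr, h1, Pi.sub_apply, h2]
      have h2 : ∫ _x in (0 : ℝ)..G.len e, κ ∂G.edgeMeasure e = G.len e * κ := by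
        rw [intervalIntegral_edgeMeasure _ (right_mem_Icc.2 hl.le),
          intervalIntegral.integral_const, sub_zero, smul_eq_mul]
      rw [SobolevPair.value, ht2, h1, intervalIntegral.integral_sub (lp_intervalIntegrable _ _ _)
        (integrable_const κ).intervalIntegrable, h2, hκ, mul_div_cancel₀ _ hl.ne', sub_self,
        add_zero]
      rfl
    have htne : ∀ e', e' ≠ e → ∀ x, t.value e' x = 0 := fun e' he' x => by
      have h1 : t.2 e' = 0 := by simp [t, he']
      rw [SobolevPair.value, h1]
      have h2 : ∫ y in (0 : ℝ)..x, (0 : Lp ℝ 2 (G.edgeMeasure e')) y ∂G.edgeMeasure e' = 0 := by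
        refine (intervalIntegral.integral_congr_ae (g := fun _ => 0) ?_).trans (by simp)
        filter_upwards [Lp.coeFn_zero ℝ 2 (G.edgeMeasure e')] with y hy _ using hy
      rw [h2, add_zero]
      rfl
    have htK : t ∈ G.sobolevSpace := fun e' => by
      by_cases h : e' = e
      · subst h; rw [hte]; rfl
      · rw [htne e' h]; rfl
    have h1 := hweak' t htK
    rw [Finset.sum_eq_single e (fun e' _ he' => by
      have h1 : t.2 e' = 0 := by simp [t, he']
      simp [h1, htne e' he']) (by simp)] at h1
    have h2 := inner_add_integral_mul_value t e (hgc e) (hP e) hPl'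
    have h3 := inner_add_integral_mul_value t e continuous_const
      (fun x => hasDerivAt_const x κ) hcl'
    have ht1 : t.1 (G.src e) = 0 := rfl
    rw [hte, ht1] at h2 h3
    simp only [zero_mul, mul_zero, sub_zero, intervalIntegral.integral_zero, add_zero] at h2 h3
    rw [ht2] at h1 h2 h3
    have hrr : inner ℝ r r = 0 := by
      have : inner ℝ r r = inner ℝ (k.2 e) r - inner ℝ Pl r - inner ℝ cl r := by
        rw [← inner_sub_left, ← inner_sub_left]
      rw [this]
      linarith
    have hr0 : r = 0 := inner_self_eq_zero.1 hrr
    refine ⟨κ, ?_⟩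
    have hke : k.2 e = cl + Pl := by
      rw [hr, sub_sub, sub_eq_zero] at hr0
      rw [hr0, add_comm]
    rw [hke]
    filter_upwards [Lp.coeFn_add cl Pl, hcl', hPl'] with x h1 h2 h3
    rw [h1, Pi.add_apply, h2, h3]
  choose κ hκ using hreg
  set F : E → ℝ → ℝ := fun e x => κ e + P e x with hFdef
  have hF : ∀ e x, HasDerivAt (F e) (g e x) x := fun e x => (hP e x).const_add _
  have hFc : ∀ e, Continuous (F e) := fun e => continuous_const.add (hPc e)
  refine ⟨hk0, F, g, ⟨fun e x hx => ?_, fun e => ?_, fun e x hx => ?_, fun v => ?_⟩, fun e => ?_⟩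
  · have h1 : HasDerivAt (fun y => k.1 (G.src e) + ∫ z in (0 : ℝ)..y, F e z) (F e x) x :=
      (((hFc e).integral_hasStrictDerivAt 0 x).hasDerivAt).const_add _
    refine h1.hasDerivWithinAt.congr (fun y hy => ?_) ?_
    · rw [toFun_pt hk hy, value_eq_of_ae_eq (hκ e) hy]
    · rw [toFun_pt hk hx, value_eq_of_ae_eq (hκ e) hx]
  · exact (memLp_edgeMeasure (hgc e) e).mono_measure
      (Measure.restrict_mono Ioo_subset_Ioc_self le_rfl)
  · simp [hFdef, hPdef]
  -- The test function is affine on each edge, `1` at `v` and `0` at the other vertices, so only the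
  -- Kirchhoff sum at `v` survives.
  · let c : V → ℝ := Pi.single v 1
    have hcont : ∀ e : E, Continuous fun _ : ℝ => (c (G.tgt e) - c (G.src e)) / G.len e :=
      fun e => continuous_const
    let t : G.SobolevPair := (c, fun e => (memLp_edgeMeasure (hcont e) e).toLp _)
    have htK : t ∈ G.sobolevSpace := fun e => by
      rw [value_eq_of_ae_eq ((memLp_edgeMeasure (hcont e) e).coeFn_toLp)
        (right_mem_Icc.2 (G.len_pos e).le), intervalIntegral.integral_const, sub_zero,
        smul_eq_mul, mul_div_cancel₀ _ (G.len_pos e).ne']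
      change c _ + (c _ - c _) = c _
      ring
    have h1 := hweak' t htK
    rw [Finset.sum_congr rfl fun e _ => by
      rw [inner_add_integral_mul_value t e (hgc e) (hF e) (hκ e), htK e],
      sum_edges_eq_sum_vertices, neg_eq_zero,
      Finset.sum_eq_single v (fun w _ hw => by
        have : t.1 w = 0 := Pi.single_eq_of_ne hw _
        rw [this, zero_mul]) (by simp)] at h1
    have h2 : t.1 v = 1 := Pi.single_eq_same _ _
    rwa [h2, one_mul] at h1
  · refine ae_restrict_of_forall_mem measurableSet_Ioo fun x hx => ?_
    have hx' := Ioo_subset_Icc_self hx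
    rw [hqp e x hx', toFun_pt hk hx']
    simp only [hg]
    ring

end WeakStrong

end MetricGraph

namespace MetricGraph

/-! ### First-order perturbation of the two lowest eigenvalues. -/

section Perturbation

/-- For the test function `x • 1 + y • u₂`, Young's inequality with weight `g = c N - W` absorbs the
cross term `2 x y β` into the slack of the `y ^ 2` term. What it costs in `x ^ 2` is paid by `lam *
L`, since constants have no Dirichlet energy; this needs `s` small. -/
theorem rayleigh_upper_bound {lam N L A β W c s x y : ℝ} (hs : 0 ≤ s) (hc : 0 ≤ c) (hL : 0 ≤ L)
    (hg : 0 < c * N - W) (hs1 : s * (A + β ^ 2 / (c * N - W)) ≤ lam * L) :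
    y ^ 2 * (lam * N) + s * (x ^ 2 * A + 2 * x * y * β + y ^ 2 * W)
      ≤ (lam + s * c) * (x ^ 2 * L + y ^ 2 * N) := by
  obtain ⟨g, hgd⟩ : ∃ g, g = c * N - W := ⟨_, rfl⟩
  rw [← hgd] at hg hs1
  have hW : W = c * N - g := by rw [hgd]; ring
  have hyoung : 2 * x * y * β ≤ g * y ^ 2 + β ^ 2 / g * x ^ 2 := by
    have h1 : g * y ^ 2 + β ^ 2 / g * x ^ 2 - 2 * x * y * β = (g * y - β * x) ^ 2 / g := by
      field_simp
      ring
    have h2 : 0 ≤ (g * y - β * x) ^ 2 / g := by positivity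
    linarith
  have h3 := mul_le_mul_of_nonneg_left hyoung hs
  have h4 := mul_le_mul_of_nonneg_left hs1 (sq_nonneg x)
  have h5 : 0 ≤ s * c * (x ^ 2 * L) := by positivity
  rw [hW]
  linarith

/-- Here `α` is the mean of the function and `B`, `D`, `W` are the mass, energy and weighted mass of
the mean-free rest. The hypothesis `hyoung`, multiplied by `θ`, bounds the cross term from below by
`-(θ α ^ 2 A + W / θ)`. The fraction `1 - θ` of `A` that is left equals `a * L`, and the losses in
`B` are covered by the spectral gap `lam * B ≤ D` for small `s`. -/
theorem rayleigh_lower_bound {lam L A γ W B D a s θ δ α : ℝ} (hs : 0 ≤ s) (hθ : 0 < θ)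
    (hθA : (1 - θ) * A = a * L) (hsa : s * (δ / θ + a) ≤ lam) (hP : lam * B ≤ D)
    (hyoung : 0 ≤ α ^ 2 * A + 2 * α * θ⁻¹ * γ + θ⁻¹ ^ 2 * W) (hW0 : 0 ≤ W) (hW : W ≤ δ * B)
    (hB : 0 ≤ B) :
    s * a * (α ^ 2 * L + 1 ^ 2 * B) ≤
      1 ^ 2 * D + s * (α ^ 2 * A + 2 * α * 1 * γ + 1 ^ 2 * W) := by
  have h2 := mul_nonneg hθ.le hyoung
  have h3 : θ * (α ^ 2 * A + 2 * α * θ⁻¹ * γ + θ⁻¹ ^ 2 * W) =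
      θ * (α ^ 2 * A) + 2 * α * γ + W / θ := by
    field_simp
  rw [h3] at h2
  have h4 : W / θ ≤ δ / θ * B := by
    rw [div_mul_eq_mul_div]
    exact div_le_div_of_nonneg_right hW hθ.le
  have h5 : α ^ 2 * A - θ * (α ^ 2 * A) = α ^ 2 * (a * L) := by rw [← hθA]; ring
  have h6 : α ^ 2 * (a * L) - δ / θ * B ≤ α ^ 2 * A + 2 * α * γ + W := by linarith
  have h7 := mul_le_mul_of_nonneg_left h6 hs
  have h8 := mul_le_mul_of_nonneg_right hsa hB
  linarith

variable {V E : Type*} {G : MetricGraph V E}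

variable (G) in
/-- The constant function `1`. -/
noncomputable def onePair : G.SobolevPair := (fun _ => 1, 0)

theorem value_onePair (e : E) (x : ℝ) : G.onePair.value e x = 1 := by
  have h : ∫ y in (0 : ℝ)..x, (0 : Lp ℝ 2 (G.edgeMeasure e)) y ∂G.edgeMeasure e = 0 := by
    refine (intervalIntegral.integral_congr_ae (g := fun _ => 0) ?_).trans (by simp)
    filter_upwards [Lp.coeFn_zero ℝ 2 (G.edgeMeasure e)] with y hy _ using hy
  change 1 + ∫ y in (0 : ℝ)..x, (0 : Lp ℝ 2 (G.edgeMeasure e)) y ∂G.edgeMeasure e = 1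
  rw [h, add_zero]

theorem onePair_mem : G.onePair ∈ G.sobolevSpace := fun e => value_onePair e _

theorem toFun_zero : (0 : G.SobolevPair).toFun = 0 := by
  have := toFun_smul (0 : ℝ) (0 : G.SobolevPair)
  rwa [zero_smul, zero_smul] at this

theorem totalLength_pos [Fintype E] [Nonempty E] (G : MetricGraph V E) : 0 < G.totalLength :=
  Finset.sum_pos (fun e _ => G.len_pos e) Finset.univ_nonempty

variable [Fintype E]

/-- Nonnegativity of all eigenvalues makes the defining set bounded below, without which the real
infimum carries no information; `0 < n` provides an eigenfunction to apply it to. -/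
theorem eigenvalue_le [DecidableEq V] {q : G.Point → ℝ} (hq : ∀ ν u, G.IsEigenfunction q ν u → 0 ≤ ν) {n : ℕ}
    (hn : 0 < n) {Λ : ℝ} {w : Fin n → G.Point → ℝ} (hw : LinearIndependent ℝ w)
    (h : ∀ i, ∃ ν ≤ Λ, G.IsEigenfunction q ν (w i)) : G.eigenvalue q n ≤ Λ := by
  refine csInf_le ⟨0, ?_⟩ ⟨w, hw, h⟩
  rintro μ ⟨w', -, hw'⟩
  obtain ⟨ν, hν, hu⟩ := hw' ⟨0, hn⟩
  exact (hq ν _ hu).trans hν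

variable [Fintype V]

theorem dirichletForm_onePair_left (h : G.SobolevPair) : G.dirichletForm G.onePair h = 0 := by
  rw [dirichletForm_apply]
  exact Finset.sum_eq_zero fun e _ => inner_zero_left _

theorem massForm_onePair : G.massForm G.onePair G.onePair = G.totalLength := by
  rw [weightForm_apply, totalLength]
  refine Finset.sum_congr rfl fun e _ => ?_
  simp [value_onePair]

theorem weightForm_add_smul_self (p : E → C(ℝ, ℝ)) (s t : ℝ) (k h : G.SobolevPair) :
    G.weightForm p (s • k + t • h) (s • k + t • h) =
      s ^ 2 * G.weightForm p k k + 2 * s * t * G.weightForm p k h + t ^ 2 * G.weightForm p h h :=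
  bilin_self_add_smul (G.weightForm p) (weightForm_comm p) s t k h

theorem weightForm_zero_left (k h : G.SobolevPair) : G.weightForm (fun _ => 0) k h = 0 := by
  rw [weightForm_apply]
  simp

theorem weightForm_eq_zero_of_toFun_eq_zero {k : G.SobolevPair} (hk : k ∈ G.sobolevSpace)
    (h0 : k.toFun = 0) (p : E → C(ℝ, ℝ)) (h : G.SobolevPair) : G.weightForm p k h = 0 := by
  rw [weightForm_apply]
  refine Finset.sum_eq_zero fun e _ => ?_
  refine (intervalIntegral.integral_congr (g := fun _ => 0) fun x hx => ?_).trans (by simp)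
  rw [uIcc_of_le (G.len_pos e).le] at hx
  simp only [← toFun_pt hk hx, h0, Pi.zero_apply, zero_mul, mul_zero]

theorem integral_toFun_sq {k : G.SobolevPair} (hk : k ∈ G.sobolevSpace) :
    G.integral (fun x => k.toFun x ^ 2) = G.massForm k k := by
  rw [weightForm_apply, integral]
  refine Finset.sum_congr rfl fun e _ => ?_
  refine intervalIntegral.integral_congr fun x hx => ?_
  rw [uIcc_of_le (G.len_pos e).le] at hx
  simp [toFun_pt hk hx, sq]

/-- If the mass vanished, the weak equation would force the Dirichlet energy to vanish as well, and
coercivity would give `k = 0`. -/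
theorem massForm_self_pos (hinc : ∀ v, ∃ e, G.src e = v ∨ G.tgt e = v) {k : G.SobolevPair}
    (hk : k ∈ G.sobolevSpace) (h0 : k ≠ 0) {p : E → C(ℝ, ℝ)}
    (hp : ∀ e, ∀ x ∈ Icc 0 (G.len e), 0 ≤ p e x) {ν : ℝ}
    (hweak : G.dirichletForm k k + G.weightForm p k k = ν * G.massForm k k) :
    0 < G.massForm k k := by
  refine (massForm_self_nonneg k).lt_of_ne fun h => h0 ?_
  have h1 := norm_sq_le_dirichletForm_add_massForm hinc hk
  have h2 := dirichletForm_self_nonneg k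
  have h3 := weightForm_self_nonneg hp k
  rw [← h, mul_zero] at hweak
  have h4 : G.dirichletForm k k = 0 := by linarith
  rw [← h, h4, add_zero, mul_zero] at h1
  exact norm_eq_zero.1 (pow_eq_zero_iff two_ne_zero |>.1 (le_antisymm h1 (sq_nonneg _)))

theorem dirichletForm_self_add (s t : ℝ) (k : G.SobolevPair) :
    G.dirichletForm (s • G.onePair + t • k) (s • G.onePair + t • k) =
      t ^ 2 * G.dirichletForm k k := by
  rw [bilin_self_add_smul G.dirichletForm dirichletForm_comm, dirichletForm_onePair_left,
    dirichletForm_onePair_left]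
  ring

theorem massForm_self_add (x y : ℝ) {k : G.SobolevPair} (hk : G.massForm G.onePair k = 0) :
    G.massForm (x • G.onePair + y • k) (x • G.onePair + y • k) =
      x ^ 2 * G.totalLength + y ^ 2 * G.massForm k k := by
  rw [weightForm_add_smul_self, hk, massForm_onePair]
  ring

variable [DecidableEq V]

/-- The weak equation is tested with the eigenfunction itself. The case `c = 0` gives nonnegative
eigenvalues, the case `c = s * a` the bound on `λ₁`. -/
theorem le_of_isEigenfunction (hinc : ∀ v, ∃ e, G.src e = v ∨ G.tgt e = v)
    {q : G.Point → ℝ} {p : E → C(ℝ, ℝ)}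
    (hqp : ∀ e, ∀ x ∈ Icc 0 (G.len e), q (G.pt e x) = p e x)
    (hp : ∀ e, ∀ x ∈ Icc 0 (G.len e), 0 ≤ p e x) {c : ℝ}
    (hc : ∀ k ∈ G.sobolevSpace, c * G.massForm k k ≤ G.dirichletForm k k + G.weightForm p k k)
    {ν : ℝ} {u : G.Point → ℝ} (hu : G.IsEigenfunction q ν u) : c ≤ ν := by
  obtain ⟨k, hk, rfl, hweak⟩ := hu.exists_weak hqp
  have h0 : k ≠ 0 := by
    rintro rfl
    exact hu.1 toFun_zero
  have hpos := massForm_self_pos hinc hk h0 hp (hweak k hk)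
  have h1 := hc k hk
  rw [hweak k hk] at h1
  exact le_of_mul_le_mul_right h1 hpos

theorem nonneg_of_isEigenfunction (hinc : ∀ v, ∃ e, G.src e = v ∨ G.tgt e = v)
    {q : G.Point → ℝ} {p : E → C(ℝ, ℝ)}
    (hqp : ∀ e, ∀ x ∈ Icc 0 (G.len e), q (G.pt e x) = p e x)
    (hp : ∀ e, ∀ x ∈ Icc 0 (G.len e), 0 ≤ p e x)
    {ν : ℝ} {u : G.Point → ℝ} (hu : G.IsEigenfunction q ν u) : 0 ≤ ν :=
  le_of_isEigenfunction hinc hqp hp (fun k _ => by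
    rw [zero_mul]
    exact add_nonneg (dirichletForm_self_nonneg k) (weightForm_self_nonneg hp k)) hu

/-- The min-max upper bound for the second eigenvalue, including the existence of two
eigenfunctions. -/
theorem exists_pair_eigenfunctions (hinc : ∀ v, ∃ e, G.src e = v ∨ G.tgt e = v)
    {q : G.Point → ℝ} {p : E → C(ℝ, ℝ)}
    (hqp : ∀ e, ∀ x ∈ Icc 0 (G.len e), q (G.pt e x) = p e x)
    (hp : ∀ e, ∀ x ∈ Icc 0 (G.len e), 0 ≤ p e x) {y z : G.SobolevPair}
    (hy : y ∈ G.sobolevSpace) (hz : z ∈ G.sobolevSpace) {Λ : ℝ}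
    (hpos : ∀ s t : ℝ, (s ≠ 0 ∨ t ≠ 0) → 0 < G.massForm (s • y + t • z) (s • y + t • z))
    (hle : ∀ s t : ℝ, G.dirichletForm (s • y + t • z) (s • y + t • z) +
      G.weightForm p (s • y + t • z) (s • y + t • z) ≤
      Λ * G.massForm (s • y + t • z) (s • y + t • z)) :
    ∃ w : Fin 2 → G.Point → ℝ, LinearIndependent ℝ w ∧
      ∀ i, ∃ ν ≤ Λ, G.IsEigenfunction q ν (w i) := by
  have hC0 : 0 ≤ 1 + ∑ e, (2 / G.len e + 2 * G.len e) := by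
    have : 0 ≤ ∑ e, (2 / G.len e + 2 * G.len e) := Finset.sum_nonneg fun e _ => by
      have := G.len_pos e
      positivity
    linarith
  obtain ⟨u, hu, w, hw, μ, hμ, ν, hν, hbu, hbw, hbuw, hau, haw⟩ :=
    exists_pair_weak_eigenvectors (G.dirichletForm + G.weightForm p) G.massForm
      (fun x y => by simp [dirichletForm_comm x y, weightForm_comm p x y])
      (weightForm_comm _) massForm_self_nonneg G.sobolevSpace isClosed_sobolevSpace
      (fun x _ => add_nonneg (dirichletForm_self_nonneg x) (weightForm_self_nonneg hp x))
      (C := 1 + ∑ e, (2 / G.len e + 2 * G.len e))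
      (fun x hx => (norm_sq_le_dirichletForm_add_massForm hinc hx).trans
        (mul_le_mul_of_nonneg_left (by
          have := weightForm_self_nonneg hp x
          simp only [add_apply]
          linarith) hC0))
      exists_subseq_massForm_cauchy hy hz hpos hle
  have hne : ∀ k ∈ G.sobolevSpace, G.massForm k k = 1 → k.toFun ≠ 0 := fun k hk h1 h0 => by
    rw [weightForm_eq_zero_of_toFun_eq_zero hk h0] at h1
    exact zero_ne_one h1
  refine ⟨![u.toFun, w.toFun], LinearIndependent.pair_iff.2 fun s t hst => ?_, fun i => ?_⟩
  · rw [← toFun_smul, ← toFun_smul, ← toFun_add] at hst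
    have hmem : s • u + t • w ∈ G.sobolevSpace :=
      Submodule.add_mem _ (Submodule.smul_mem _ s hu) (Submodule.smul_mem _ t hw)
    have h1 := weightForm_eq_zero_of_toFun_eq_zero hmem hst (fun _ => 1) u
    have h2 := weightForm_eq_zero_of_toFun_eq_zero hmem hst (fun _ => 1) w
    have hbwu : G.massForm w u = 0 := by rw [weightForm_comm]; exact hbuw
    simp only [map_add, map_smul, add_apply, smul_apply, smul_eq_mul, hbu, hbw, hbuw, hbwu]
      at h1 h2
    constructor <;> linarith
  · fin_cases i
    · exact ⟨μ, hμ, isEigenfunction_of_weak hqp hu (hne u hu hbu) hau⟩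
    · exact ⟨ν, hν, isEigenfunction_of_weak hqp hw (hne w hw hbw) haw⟩

/-- The variational characterization of the second eigenvalue of the Laplacian. -/
theorem eigenvalue_zero_two_mul_le [Nonempty E] (hinc : ∀ v, ∃ e, G.src e = v ∨ G.tgt e = v)
    {k : G.SobolevPair} (hk : k ∈ G.sobolevSpace) (h1 : G.massForm G.onePair k = 0) :
    G.eigenvalue 0 2 * G.massForm k k ≤ G.dirichletForm k k := by
  have hD := dirichletForm_self_nonneg k
  have hL := totalLength_pos G
  rcases (massForm_self_nonneg k).eq_or_lt with h | h
  · rwa [← h, mul_zero]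
  rw [← le_div_iff₀ h]
  have hqp : ∀ e, ∀ x ∈ Icc 0 (G.len e), (0 : G.Point → ℝ) (G.pt e x) = (0 : C(ℝ, ℝ)) x :=
    fun _ _ _ => rfl
  have hp : ∀ e : E, ∀ x ∈ Icc 0 (G.len e), 0 ≤ (0 : C(ℝ, ℝ)) x := fun _ _ _ => le_rfl
  have hb : ∀ s t : ℝ, G.massForm (s • G.onePair + t • k) (s • G.onePair + t • k) =
      s ^ 2 * G.totalLength + t ^ 2 * G.massForm k k := fun s t => by
    rw [weightForm_add_smul_self, h1, massForm_onePair]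
    ring
  -- On the span of `1` and `k` the Rayleigh quotient is at most that of `k`: the constant part adds
  -- mass but no energy.
  obtain ⟨w, hw, hw'⟩ := exists_pair_eigenfunctions hinc hqp hp onePair_mem hk
    (Λ := G.dirichletForm k k / G.massForm k k)
    (fun s t hst => by
      rw [hb]
      rcases hst with hs | ht
      · positivity
      · positivity)
    (fun s t => by
      rw [weightForm_zero_left, add_zero, dirichletForm_self_add, hb, mul_add]
      have h2 : G.dirichletForm k k / G.massForm k k * (t ^ 2 * G.massForm k k)
          = t ^ 2 * G.dirichletForm k k := by
        field_simp
      have h3 : 0 ≤ G.dirichletForm k k / G.massForm k k * (s ^ 2 * G.totalLength) := by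
        positivity
      linarith)
  exact eigenvalue_le (fun ν u => nonneg_of_isEigenfunction hinc hqp hp) two_pos hw hw'

/-- Constants are eigenfunctions for `0`. This half suffices, since only `λ₂(0) ≤ Γ[0]` is used. -/
theorem eigenvalue_zero_one_nonpos [Nonempty E] (hinc : ∀ v, ∃ e, G.src e = v ∨ G.tgt e = v) :
    G.eigenvalue 0 1 ≤ 0 := by
  have hqp : ∀ e, ∀ x ∈ Icc 0 (G.len e), (0 : G.Point → ℝ) (G.pt e x) = (0 : C(ℝ, ℝ)) x :=
    fun _ _ _ => rfl
  have hp : ∀ e : E, ∀ x ∈ Icc 0 (G.len e), 0 ≤ (0 : C(ℝ, ℝ)) x := fun _ _ _ => le_rfl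
  have h0 : G.onePair.toFun ≠ 0 := fun h => by
    have h1 := weightForm_eq_zero_of_toFun_eq_zero onePair_mem h (fun _ => 1) G.onePair
    rw [massForm_onePair] at h1
    exact (totalLength_pos G).ne' h1
  refine eigenvalue_le (fun ν u => nonneg_of_isEigenfunction hinc hqp hp) one_pos
    (w := fun _ => G.onePair.toFun) (LinearIndependent.of_subsingleton 0 h0) fun _ =>
      ⟨0, le_rfl, isEigenfunction_of_weak hqp onePair_mem h0 fun h _ => ?_⟩
  rw [dirichletForm_onePair_left, weightForm_zero_left, zero_mul, add_zero]

/-- A first order lower bound for the energy. -/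
theorem smul_massForm_le [Nonempty E] (hinc : ∀ v, ∃ e, G.src e = v ∨ G.tgt e = v)
    {p : E → C(ℝ, ℝ)} (hp : ∀ e, ∀ x ∈ Icc 0 (G.len e), 0 ≤ p e x) {δ : ℝ}
    (hδ : ∀ e, ∀ x ∈ Icc 0 (G.len e), p e x ≤ δ) {a s θ : ℝ} (hs : 0 ≤ s) (hθ : 0 < θ)
    (hθA : (1 - θ) * G.weightForm p G.onePair G.onePair = a * G.totalLength)
    (hsa : s * (δ / θ + a) ≤ G.eigenvalue 0 2) {h : G.SobolevPair} (hh : h ∈ G.sobolevSpace) :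
    s * a * G.massForm h h ≤ G.dirichletForm h h + G.weightForm (s • p) h h := by
  have hL := totalLength_pos G
  obtain ⟨α, hα⟩ : ∃ α, α = G.massForm G.onePair h / G.totalLength := ⟨_, rfl⟩
  obtain ⟨z, hz⟩ : ∃ z, z = h - α • G.onePair := ⟨_, rfl⟩
  have hzK : z ∈ G.sobolevSpace := by
    rw [hz]
    exact Submodule.sub_mem _ hh (Submodule.smul_mem _ _ onePair_mem)
  have hz1 : G.massForm G.onePair z = 0 := by
    rw [hz, map_sub, map_smul, massForm_onePair, hα, smul_eq_mul,
      div_mul_cancel₀ _ hL.ne', sub_self]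
  have hhz : h = α • G.onePair + (1 : ℝ) • z := by rw [hz]; simp
  have hP := eigenvalue_zero_two_mul_le hinc hzK hz1
  -- The factor `θ⁻¹` is the Young weight: nonnegativity at this vector controls the cross term
  -- between the mean and the rest.
  have hyoung := weightForm_self_nonneg hp (α • G.onePair + θ⁻¹ • z)
  rw [hhz, weightForm_smul, dirichletForm_self_add, massForm_self_add _ _ hz1,
    weightForm_add_smul_self]
  rw [weightForm_add_smul_self] at hyoung
  have hWz : G.weightForm p z z ≤ δ * G.massForm z z := by
    rw [← weightForm_smul]
    exact weightForm_mono (fun e x hx => by simpa using hδ e x hx) z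
  exact rayleigh_lower_bound hs hθ hθA hsa hP hyoung (weightForm_self_nonneg hp z) hWz
    (massForm_self_nonneg z)

/-- First order perturbation of the gap: it decreases in the direction of a potential whose mean
with respect to the square of a second eigenfunction is less than its mean. -/
theorem exists_gap_smul_lt [Nonempty E] (hinc : ∀ v, ∃ e, G.src e = v ∨ G.tgt e = v)
    {q : G.Point → ℝ} {p : E → C(ℝ, ℝ)}
    (hqp : ∀ e, ∀ x ∈ Icc 0 (G.len e), q (G.pt e x) = p e x)
    (hp : ∀ e, ∀ x ∈ Icc 0 (G.len e), 0 ≤ p e x) {δ : ℝ} (hδ0 : 0 ≤ δ)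
    (hδ : ∀ e, ∀ x ∈ Icc 0 (G.len e), p e x ≤ δ)
    {k : G.SobolevPair} (hk : k ∈ G.sobolevSpace)
    (hweak : ∀ h ∈ G.sobolevSpace, G.dirichletForm k h = G.eigenvalue 0 2 * G.massForm k h)
    (hlam : 0 < G.eigenvalue 0 2) (hN : 0 < G.massForm k k)
    (hlt : G.weightForm p k k / G.massForm k k <
      G.weightForm p G.onePair G.onePair / G.totalLength) {S : ℝ} (hS : 0 < S) :
    ∃ s, 0 < s ∧ s ≤ S ∧ G.gap (s • q) < G.gap 0 := by
  have hL := totalLength_pos G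
  -- `c` will bound the slope of `λ₂` from above and `a` that of `λ₁` from below.
  obtain ⟨c, hc, hca⟩ := exists_between hlt
  obtain ⟨a, hca, ha⟩ := exists_between hca
  have hc0 : 0 < c := (div_nonneg (weightForm_self_nonneg hp k) hN.le).trans_lt hc
  have ha0 : 0 < a := hc0.trans hca
  have hA0 : 0 < G.weightForm p G.onePair G.onePair :=
    (div_pos_iff_of_pos_right hL).1 (ha0.trans ha)
  have hg : 0 < c * G.massForm k k - G.weightForm p k k := sub_pos.2 ((div_lt_iff₀ hN).1 hc)
  have haL : a * G.totalLength < G.weightForm p G.onePair G.onePair := (lt_div_iff₀ hL).1 ha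
  -- `θ` is the fraction of the mean of `p` that can be given up while keeping the slope `a`.
  obtain ⟨θ, hθ0, hθA⟩ : ∃ θ, 0 < θ ∧
      (1 - θ) * G.weightForm p G.onePair G.onePair = a * G.totalLength :=
    ⟨1 - a * G.totalLength / G.weightForm p G.onePair G.onePair,
      sub_pos.2 ((div_lt_one hA0).2 haL), by rw [sub_sub_cancel, div_mul_cancel₀ _ hA0.ne']⟩
  have hk1 : G.massForm G.onePair k = 0 := by
    have h1 := hweak _ onePair_mem
    rw [dirichletForm_comm, dirichletForm_onePair_left, weightForm_comm] at h1
    exact (mul_eq_zero.1 h1.symm).resolve_left hlam.ne'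
  -- The two smallness conditions are those of `rayleigh_upper_bound` and `rayleigh_lower_bound`.
  obtain ⟨s, hs0, hsS, hs1, hs2⟩ : ∃ s, 0 < s ∧ s ≤ S ∧
      s * (G.weightForm p G.onePair G.onePair + (G.weightForm p G.onePair k) ^ 2 /
        (c * G.massForm k k - G.weightForm p k k)) ≤ G.eigenvalue 0 2 * G.totalLength ∧
      s * (δ / θ + a) ≤ G.eigenvalue 0 2 := by
    have h1 : 0 < G.weightForm p G.onePair G.onePair + (G.weightForm p G.onePair k) ^ 2 /
        (c * G.massForm k k - G.weightForm p k k) :=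
      add_pos_of_pos_of_nonneg hA0 (div_nonneg (sq_nonneg _) hg.le)
    have h2 : 0 < δ / θ + a := add_pos_of_nonneg_of_pos (div_nonneg hδ0 hθ0.le) ha0
    refine ⟨min S (min _ _), lt_min hS (lt_min (div_pos (mul_pos hlam hL) h1) (div_pos hlam h2)),
      min_le_left _ _, ?_, ?_⟩
    · exact (le_div_iff₀ h1).1 ((min_le_right _ _).trans (min_le_left _ _))
    · exact (le_div_iff₀ h2).1 ((min_le_right _ _).trans (min_le_right _ _))
  have hqp' : ∀ e, ∀ x ∈ Icc 0 (G.len e), (s • q) (G.pt e x) = (s • p) e x := fun e x hx => by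
    simp [hqp e x hx]
  have hp' : ∀ e, ∀ x ∈ Icc 0 (G.len e), 0 ≤ (s • p) e x := fun e x hx => by
    simpa using mul_nonneg hs0.le (hp e x hx)
  obtain ⟨w, hw, hw'⟩ := exists_pair_eigenfunctions hinc hqp' hp' onePair_mem hk
    (Λ := G.eigenvalue 0 2 + s * c)
    (fun x y hxy => by
      rw [massForm_self_add _ _ hk1]
      rcases hxy with h | h
      · exact add_pos_of_pos_of_nonneg (mul_pos (by positivity) hL)
          (mul_nonneg (sq_nonneg _) hN.le)
      · exact add_pos_of_nonneg_of_pos (mul_nonneg (sq_nonneg _) hL.le)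
          (mul_pos (by positivity) hN))
    (fun x y => by
      rw [massForm_self_add _ _ hk1, dirichletForm_self_add, hweak k hk, weightForm_smul,
        weightForm_add_smul_self]
      exact rayleigh_upper_bound hs0.le hc0.le hL.le hg hs1)
  have hup : G.eigenvalue (s • q) 2 ≤ G.eigenvalue 0 2 + s * c :=
    eigenvalue_le (fun ν u => nonneg_of_isEigenfunction hinc hqp' hp') two_pos hw hw'
  have hlow : s * a ≤ G.eigenvalue (s • q) 1 := by
    -- The eigenfunction `w 0` from the upper bound shows that the defining set is nonempty; over
    -- the empty set the infimum would be the default value `0`.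
    refine le_csInf ⟨G.eigenvalue 0 2 + s * c, fun _ => w 0,
      LinearIndependent.of_subsingleton 0 (hw.ne_zero 0), fun _ => hw' 0⟩ ?_
    rintro μ ⟨f, -, hf⟩
    obtain ⟨ν, hν, hu⟩ := hf 0
    exact le_trans (le_of_isEigenfunction hinc hqp' hp'
      (fun h hh => smul_massForm_le hinc hp hδ hs0.le hθ0 hθA hs2 hh) hu) hν
  refine ⟨s, hs0, hsS, ?_⟩
  have h0 := eigenvalue_zero_one_nonpos hinc
  have h1 := mul_lt_mul_of_pos_left hca hs0
  simp only [gap]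
  linarith

end Perturbation

end MetricGraph

namespace MetricGraph

/-! ### The leaf potential and its convexity along paths. -/

section Leaf

variable {V E : Type*} {G : MetricGraph V E}

/-- Edge ends at `v` correspond to oriented edges starting at `v`, and a leaf has exactly one. -/
theorem IsLeaf.exists_unique_origin [DecidableEq V] [Fintype E] {v : V} (hv : G.IsLeaf v) :
    ∃ d, G.origin d = v ∧ ∀ d', G.origin d' = v → d' = d := by
  rw [IsLeaf, degree, Nat.add_eq_one_iff] at hv
  rcases hv with ⟨h0, h1⟩ | ⟨h1, h0⟩
  · obtain ⟨e, he⟩ := Finset.card_eq_one.1 h1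
    have hmem : ∀ f, G.tgt f = v ↔ f = e := fun f => by
      simpa using Finset.ext_iff.1 he f
    have hsrc : ∀ f, G.src f ≠ v := by simpa [Finset.filter_eq_empty_iff] using h0
    refine ⟨(e, false), (hmem e).2 rfl, ?_⟩
    rintro ⟨f, _ | _⟩ hf
    · rw [(hmem f).1 hf]
    · exact absurd hf (hsrc f)
  · obtain ⟨e, he⟩ := Finset.card_eq_one.1 h1
    have hmem : ∀ f, G.src f = v ↔ f = e := fun f => by
      simpa using Finset.ext_iff.1 he f
    have htgt : ∀ f, G.tgt f ≠ v := by simpa [Finset.filter_eq_empty_iff] using h0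
    refine ⟨(e, true), (hmem e).2 rfl, ?_⟩
    rintro ⟨f, _ | _⟩ hf
    · exact absurd hf (htgt f)
    · rw [(hmem f).1 hf]

variable (G) in
/-- The coordinate on an oriented edge of the point at distance `t` from its origin. -/
def coord (d : E × Bool) (t : ℝ) : ℝ := if d.2 then t else G.len d.1 - t

theorem coord_coord (d : E × Bool) (t : ℝ) : G.coord d (G.coord d t) = t := by
  unfold coord; split_ifs <;> ring

theorem coord_not (e : E) (b : Bool) (t : ℝ) :
    G.coord (e, !b) t = G.coord (e, b) (G.len e - t) := by
  cases b <;> simp [coord]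

theorem coord_mem_Icc {d : E × Bool} {t : ℝ} (ht : t ∈ Icc 0 (G.len d.1)) :
    G.coord d t ∈ Icc 0 (G.len d.1) := by
  unfold coord
  split_ifs
  · exact ht
  · exact ⟨by linarith [ht.2], by linarith [ht.1]⟩

theorem coord_mem_Ioo {d : E × Bool} {t : ℝ} (ht : t ∈ Ioo 0 (G.len d.1)) :
    G.coord d t ∈ Ioo 0 (G.len d.1) := by
  unfold coord
  split_ifs
  · exact ht
  · exact ⟨by linarith [ht.2], by linarith [ht.1]⟩

@[fun_prop]
theorem continuous_coord (d : E × Bool) : Continuous (G.coord d) := by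
  unfold coord; split_ifs <;> fun_prop

theorem pt_coord_zero (d : E × Bool) : G.pt d.1 (G.coord d 0) = Point.vertex (G.origin d) := by
  rcases d with ⟨e, _ | _⟩
  · simpa [coord, origin] using pt_of_len_le e le_rfl
  · simpa [coord, origin] using pt_of_nonpos e le_rfl

theorem pt_coord_len (d : E × Bool) :
    G.pt d.1 (G.coord d (G.len d.1)) = Point.vertex (G.terminus d) := by
  rcases d with ⟨e, _ | _⟩
  · simpa [coord, terminus] using pt_of_nonpos e le_rfl
  · simpa [coord, terminus] using pt_of_len_le e le_rfl

theorem trace_cons_of_le (a : V) (d : E × Bool) (l : List (E × Bool)) {t : ℝ}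
    (ht : t ≤ G.len d.1) : G.trace a (d :: l) t = G.pt d.1 (G.coord d t) := by
  rw [trace, if_pos ht]; rfl

theorem trace_cons_of_lt (a : V) (d : E × Bool) (l : List (E × Bool)) {t : ℝ}
    (ht : G.len d.1 < t) : G.trace a (d :: l) t = G.trace (G.terminus d) l (t - G.len d.1) := by
  rw [trace, if_neg (not_le.2 ht)]

theorem pathLength_cons (d : E × Bool) (l : List (E × Bool)) :
    G.pathLength (d :: l) = G.len d.1 + G.pathLength l := rfl

theorem pathLength_nonneg (l : List (E × Bool)) : 0 ≤ G.pathLength l :=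
  List.sum_nonneg fun _ hx => by
    obtain ⟨d, -, rfl⟩ := List.mem_map.1 hx
    exact (G.len_pos d.1).le

open Classical in
variable (G) in
/-- The potential `max (0, δ - dist)` near the origin of an oriented edge, in edge coordinates. -/
noncomputable def leafProfile (d : E × Bool) (δ : ℝ) (e : E) : C(ℝ, ℝ) :=
  if e = d.1 then ⟨fun x => max 0 (δ - G.coord d x), by fun_prop⟩ else 0

theorem leafProfile_self (d : E × Bool) (δ x : ℝ) :
    G.leafProfile d δ d.1 x = max 0 (δ - G.coord d x) := by
  simp [leafProfile]

theorem leafProfile_of_ne {d : E × Bool} {e : E} (he : e ≠ d.1) (δ x : ℝ) :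
    G.leafProfile d δ e x = 0 := by
  simp [leafProfile, he]

theorem leafProfile_nonneg (d : E × Bool) (δ : ℝ) (e : E) (x : ℝ) : 0 ≤ G.leafProfile d δ e x := by
  by_cases he : e = d.1
  · subst he; rw [leafProfile_self]; exact le_max_left _ _
  · rw [leafProfile_of_ne he]

theorem leafProfile_le (d : E × Bool) {δ : ℝ} (hδ : 0 ≤ δ) {e : E} {x : ℝ}
    (hx : x ∈ Icc 0 (G.len e)) : G.leafProfile d δ e x ≤ δ := by
  by_cases he : e = d.1
  · subst he
    rw [leafProfile_self]
    exact max_le hδ (by linarith [(coord_mem_Icc (d := d) hx).1])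
  · rwa [leafProfile_of_ne he]

open Classical in
variable (G) in
/-- The potential `max (0, δ - dist)` near the origin of an oriented edge. -/
noncomputable def leafPotential (d : E × Bool) (δ : ℝ) : G.Point → ℝ
  | Point.vertex w => if w = G.origin d then δ else 0
  | Point.interior e x _ => G.leafProfile d δ e x

theorem leafPotential_nonneg (d : E × Bool) {δ : ℝ} (hδ : 0 ≤ δ) (x : G.Point) :
    0 ≤ G.leafPotential d δ x := by
  rcases x with w | ⟨e, x, hx⟩
  · simp only [leafPotential]
    split_ifs
    · exact hδ
    · exact le_rfl
  · exact leafProfile_nonneg d δ e x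

theorem leafPotential_le (d : E × Bool) {δ : ℝ} (hδ : 0 ≤ δ) (x : G.Point) :
    G.leafPotential d δ x ≤ δ := by
  rcases x with w | ⟨e, x, hx⟩
  · simp only [leafPotential]
    split_ifs
    · exact le_rfl
    · exact hδ
  · exact leafProfile_le d hδ (Ioo_subset_Icc_self hx)

variable {d₀ : E × Bool} {δ : ℝ}

theorem eq_or_eq_not {d : E × Bool} (h : d.1 = d₀.1) :
    d = d₀ ∨ d = (d₀.1, !d₀.2) := by
  rcases d with ⟨e, b⟩
  rcases d₀ with ⟨e₀, b₀⟩
  cases b <;> cases b₀ <;> simp_all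

theorem origin_not (d : E × Bool) : G.origin (d.1, !d.2) = G.terminus d := by
  rcases d with ⟨e, _ | _⟩ <;> simp [origin, terminus]

theorem terminus_not (d : E × Bool) : G.terminus (d.1, !d.2) = G.origin d := by
  rcases d with ⟨e, _ | _⟩ <;> simp [origin, terminus]

/-- The edge profiles fit together at the vertices: `δ ≤ len` makes the profile vanish at the far
end of the leaf edge, and by `huniq` no other edge touches the leaf. -/
theorem leafPotential_pt (hloop : G.origin d₀ ≠ G.terminus d₀)
    (huniq : ∀ d, G.origin d = G.origin d₀ → d = d₀) (hδ : 0 ≤ δ) (hδl : δ ≤ G.len d₀.1) {e : E}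
    {x : ℝ} (hx : x ∈ Icc 0 (G.len e)) :
    G.leafPotential d₀ δ (G.pt e x) = G.leafProfile d₀ δ e x := by
  by_cases he : e = d₀.1
  · subst he
    obtain ⟨t, ht, rfl⟩ : ∃ t ∈ Icc 0 (G.len d₀.1), x = G.coord d₀ t :=
      ⟨_, coord_mem_Icc hx, (coord_coord d₀ x).symm⟩
    rw [leafProfile_self, coord_coord]
    rcases eq_zero_or_len_or_mem_Ioo ht with rfl | rfl | h
    · rw [pt_coord_zero, sub_zero, max_eq_right hδ]
      exact if_pos rfl
    · rw [pt_coord_len, max_eq_left (by linarith)]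
      exact if_neg hloop.symm
    · rw [pt_of_mem_Ioo (coord_mem_Ioo h)]
      exact (leafProfile_self _ _ _).trans (by rw [coord_coord])
  · rw [leafProfile_of_ne he]
    rcases eq_zero_or_len_or_mem_Ioo hx with rfl | rfl | h
    · rw [pt_of_nonpos e le_rfl]
      refine if_neg fun h => he ?_
      rw [← huniq (e, true) h]
    · rw [pt_of_len_le e le_rfl]
      refine if_neg fun h => he ?_
      rw [← huniq (e, false) h]
    · rw [pt_of_mem_Ioo h]
      exact leafProfile_of_ne he δ x

theorem eq_not_of_terminus_eq (huniq : ∀ d, G.origin d = G.origin d₀ → d = d₀) {d : E × Bool}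
    (h : G.terminus d = G.origin d₀) : d = (d₀.1, !d₀.2) := by
  have h1 := huniq (d.1, !d.2) (by rw [origin_not, h])
  rw [← h1]
  simp

/-- The leaf can be entered only through its own edge, so the walk contains that whole edge. -/
theorem len_le_pathLength (huniq : ∀ d, G.origin d = G.origin d₀ → d = d₀) :
    ∀ (l : List (E × Bool)) (a : V), G.IsWalk a l (G.origin d₀) → a ≠ G.origin d₀ →
      G.len d₀.1 ≤ G.pathLength l
  | [], _, hl, ha => absurd hl ha
  | d :: l, a, hl, ha => by
    rw [pathLength_cons]
    by_cases h : G.terminus d = G.origin d₀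
    · rw [eq_not_of_terminus_eq huniq h]
      linarith [pathLength_nonneg (G := G) l]
    · linarith [len_le_pathLength huniq l _ hl.2 h, G.len_pos d.1]

open Classical in
/-- The leaf potential along a path that does not start at the leaf. -/
theorem leafPotential_trace (hloop : G.origin d₀ ≠ G.terminus d₀)
    (huniq : ∀ d, G.origin d = G.origin d₀ → d = d₀) (hδ : 0 ≤ δ) (hδl : δ ≤ G.len d₀.1) {b : V} :
    ∀ (l : List (E × Bool)) (a : V), G.IsPath a l b → a ≠ G.origin d₀ →
      ∀ t ∈ Icc 0 (G.pathLength l), G.leafPotential d₀ δ (G.trace a l t) =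
        if b = G.origin d₀ then max 0 (δ - (G.pathLength l - t)) else 0
  | [], a, hl, ha, t, _ => by
    have hab : a = b := hl.1
    subst hab
    rw [if_neg ha]
    exact if_neg ha
  | d :: l, a, ⟨⟨hda, hw⟩, hnd⟩, ha, t, ht => by
    rw [pathLength_cons] at ht ⊢
    have hnd' : (G.terminus d :: l.map G.terminus).Nodup := (List.nodup_cons.1 hnd).2
    by_cases h : G.terminus d = G.origin d₀
    · have hd := eq_not_of_terminus_eq huniq h
      cases l with
      | nil =>
        have hb : G.terminus d = b := hw
        have hl0 : G.pathLength ([] : List (E × Bool)) = 0 := rfl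
        rw [hl0, add_zero] at ht
        rw [if_pos (hb.symm.trans h), trace_cons_of_le _ _ _ ht.2,
          leafPotential_pt hloop huniq hδ hδl (coord_mem_Icc ht), hl0, add_zero, hd,
          coord_not, leafProfile_self, coord_coord]
      | cons d' l =>
        exfalso
        -- A walk that continues after reaching the leaf must turn back along `d₀` and revisits `a`.
        have hd' : d' = d₀ := huniq d' (hw.1.trans h)
        refine (List.nodup_cons.1 hnd).1 ?_
        have : a = G.terminus d' := by rw [← hda, hd, hd', ← terminus_not (d₀.1, !d₀.2)]; simp
        simp [this]
    · have hd : d.1 ≠ d₀.1 := fun hd => by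
        rcases eq_or_eq_not hd with rfl | rfl
        · exact ha hda.symm
        · exact h (terminus_not d₀)
      rcases le_or_gt t (G.len d.1) with htl | htl
      · rw [trace_cons_of_le _ _ _ htl,
          leafPotential_pt hloop huniq hδ hδl (coord_mem_Icc ⟨ht.1, htl⟩), leafProfile_of_ne hd]
        split_ifs with hb
        · subst hb
          -- The leaf edge is still ahead, so the remaining distance is at least `len ≥ δ` and the
          -- profile is zero here.
          have := len_le_pathLength huniq l _ hw h
          rw [max_eq_left (by linarith)]
        · rfl
      · rw [trace_cons_of_lt _ _ _ htl, leafPotential_trace hloop huniq hδ hδl l _ ⟨hw, hnd'⟩ h _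
          ⟨by linarith, by linarith [ht.2]⟩]
        have : G.pathLength l - (t - G.len d.1) = G.len d.1 + G.pathLength l - t := by ring
        rw [this]

theorem convexOn_max_affine (s : Set ℝ) (hs : Convex ℝ s) (m c : ℝ) :
    ConvexOn ℝ s fun t => max 0 (c + m * t) := by
  refine ConvexOn.sup (convexOn_const 0 hs) ⟨hs, fun x _ y _ a b _ _ hab => le_of_eq ?_⟩
  simp only [smul_eq_mul]
  linear_combination (-c) * hab

/-- The leaf potential is convex along every path that joins two distinct vertices. -/
theorem convexOn_leafPotential (hloop : G.origin d₀ ≠ G.terminus d₀)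
    (huniq : ∀ d, G.origin d = G.origin d₀ → d = d₀) (hδ : 0 ≤ δ) (hδl : δ ≤ G.len d₀.1) {a b : V}
    (hab : a ≠ b) {l : List (E × Bool)} (hl : G.IsPath a l b) :
    ConvexOn ℝ (Icc 0 (G.pathLength l)) fun t => G.leafPotential d₀ δ (G.trace a l t) := by
  have hconv : Convex ℝ (Icc 0 (G.pathLength l)) := convex_Icc _ _
  by_cases ha : a = G.origin d₀
  · subst ha
    cases l with
    | nil => exact absurd hl.1 hab
    | cons d l =>
      obtain ⟨⟨hda, hw⟩, hnd⟩ := hl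
      have hd : d = d₀ := huniq d hda
      subst hd
      -- Along a path leaving the leaf the potential is `max 0 (δ - t)` throughout: past the first
      -- edge `t > len ≥ δ`, and the path does not end at the leaf.
      refine (convexOn_max_affine _ hconv (-1) δ).congr fun t ht => ?_
      rw [pathLength_cons] at ht
      simp only
      rcases le_or_gt t (G.len d.1) with htl | htl
      · rw [trace_cons_of_le _ _ _ htl,
          leafPotential_pt hloop huniq hδ hδl (coord_mem_Icc ⟨ht.1, htl⟩), leafProfile_self,
          coord_coord]
        congr 1; ring
      · rw [trace_cons_of_lt _ _ _ htl, leafPotential_trace hloop huniq hδ hδl l _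
          ⟨hw, (List.nodup_cons.1 hnd).2⟩ hloop.symm _ ⟨by linarith, by linarith [ht.2]⟩,
          if_neg hab.symm, max_eq_left (by linarith)]
  · by_cases hb : b = G.origin d₀
    · refine (convexOn_max_affine _ hconv 1 (δ - G.pathLength l)).congr fun t ht => ?_
      simp only
      rw [leafPotential_trace hloop huniq hδ hδl l a hl ha t ht, if_pos hb]
      congr 1; ring
    · refine (convexOn_const 0 hconv).congr fun t ht => ?_
      simp only
      rw [leafPotential_trace hloop huniq hδ hδl l a hl ha t ht, if_neg hb]

theorem smul_leafPotential_mem_convexClass [DecidableEq V] [Fintype E]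
    (hloop : G.origin d₀ ≠ G.terminus d₀)
    (huniq : ∀ d, G.origin d = G.origin d₀ → d = d₀) (hδ : 0 ≤ δ) (hδl : δ ≤ G.len d₀.1)
    {s M : ℝ} (hs : 0 ≤ s) (hsM : s * δ ≤ M) : s • G.leafPotential d₀ δ ∈ G.convexClass M := by
  refine ⟨fun x => ⟨mul_nonneg hs (leafPotential_nonneg d₀ hδ x), ?_⟩, ?_⟩
  · exact (mul_le_mul_of_nonneg_left (leafPotential_le d₀ hδ x) hs).trans hsM
  · intro a b _ _ hab l hl
    exact (convexOn_leafPotential hloop huniq hδ hδl hab hl).smul hs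

end Leaf

/-! ### Choice of the potential and conclusion. -/

section Main

variable {V E : Type*} {G : MetricGraph V E}

theorem exists_edge_of_adj {a b : V} (h : G.toSimpleGraph.Adj a b) :
    ∃ e, (G.src e = a ∧ G.tgt e = b) ∨ (G.src e = b ∧ G.tgt e = a) := by
  obtain ⟨-, ⟨e, he⟩ | ⟨e, he⟩⟩ := (SimpleGraph.fromRel_adj _ _ _).1 h
  · exact ⟨e, Or.inl he⟩
  · exact ⟨e, Or.inr he⟩

theorem exists_incident_edge (hG : G.toSimpleGraph.Connected) (d₀ : E × Bool) (w : V) :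
    ∃ e, G.src e = w ∨ G.tgt e = w := by
  obtain ⟨p⟩ := hG.preconnected w (G.origin d₀)
  cases p with
  | nil =>
    refine ⟨d₀.1, ?_⟩
    rcases d₀ with ⟨e, _ | _⟩
    · exact Or.inr (by simp [origin])
    · exact Or.inl (by simp [origin])
  | cons h _ =>
    obtain ⟨e, he⟩ := exists_edge_of_adj h
    exact ⟨e, he.imp And.left And.right⟩

variable [Fintype V] [Fintype E]

/-- Zero energy makes the function constant on each edge, and connectedness carries the constant
along walks. It serves to exclude `λ₂(0) = 0`. -/
theorem value_eq_of_dirichletForm_eq_zero (hG : G.toSimpleGraph.Connected) {k : G.SobolevPair}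
    (hk : k ∈ G.sobolevSpace) (h0 : G.dirichletForm k k = 0) (v : V) (e : E) (x : ℝ) :
    k.value e x = k.1 v := by
  have hf : ∀ e, ‖k.2 e‖ = 0 := fun e => by
    rw [norm_eq_zero, ← inner_self_eq_zero (𝕜 := ℝ)]
    exact (Finset.sum_eq_zero_iff_of_nonneg fun e _ => real_inner_self_nonneg).1 h0 e
      (Finset.mem_univ e)
  have hval : ∀ e x, k.value e x = k.1 (G.src e) := fun e x => by
    have h := abs_value_sub_value_le k e x 0
    rw [hf e, mul_zero, value_zero_right] at h
    exact sub_eq_zero.1 (abs_eq_zero.1 (le_antisymm h (abs_nonneg _)))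
  have hedge : ∀ e, k.1 (G.tgt e) = k.1 (G.src e) := fun e => by rw [← hk e, hval]
  have hwalk : ∀ {a b : V}, G.toSimpleGraph.Walk a b → k.1 a = k.1 b := fun w => by
    induction w with
    | nil => rfl
    | cons h _ ih =>
      obtain ⟨e, ⟨h1, h2⟩ | ⟨h1, h2⟩⟩ := exists_edge_of_adj h
      · rw [← ih, ← h1, ← h2, hedge]
      · rw [← ih, ← h1, ← h2, hedge]
  obtain ⟨w⟩ := hG.preconnected (G.src e) v
  rw [hval, hwalk w]

/-- The profile vanishes at distance `δ` or more from the leaf, so a bound on the square nearer than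
that suffices. -/
theorem weightForm_leafProfile_le {d₀ : E × Bool} {δ m : ℝ} {k : G.SobolevPair}
    (hm : ∀ t ∈ Icc 0 (G.len d₀.1), t < δ → k.value d₀.1 (G.coord d₀ t) ^ 2 ≤ m) :
    G.weightForm (G.leafProfile d₀ δ) k k ≤
      m * G.weightForm (G.leafProfile d₀ δ) G.onePair G.onePair := by
  rw [weightForm_apply, weightForm_apply, Finset.mul_sum]
  refine Finset.sum_le_sum fun e _ => ?_
  rw [← intervalIntegral.integral_const_mul]
  refine intervalIntegral.integral_mono_on (μ := volume) (G.len_pos e).le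
    (Continuous.intervalIntegrable (by fun_prop) _ _)
    (Continuous.intervalIntegrable (by fun_prop) _ _) fun x hx => ?_
  rw [value_onePair, mul_one, mul_one, mul_comm m]
  by_cases he : e = d₀.1
  · subst he
    rcases lt_or_ge (G.coord d₀ x) δ with h | h
    · refine mul_le_mul_of_nonneg_left ?_ (leafProfile_nonneg _ _ _ _)
      have := hm _ (coord_mem_Icc hx) h
      rwa [coord_coord, sq] at this
    · rw [leafProfile_self, max_eq_left (by linarith)]
      simp
  · rw [leafProfile_of_ne he]
    simp

theorem weightForm_leafProfile_one_pos (d₀ : E × Bool) {δ : ℝ} (hδ : 0 < δ) :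
    0 < G.weightForm (G.leafProfile d₀ δ) G.onePair G.onePair := by
  rw [weightForm_apply]
  refine Finset.sum_pos' (fun e _ => intervalIntegral.integral_nonneg (G.len_pos e).le
    fun x _ => mul_nonneg (leafProfile_nonneg _ _ _ _) (mul_self_nonneg _))
    ⟨d₀.1, Finset.mem_univ _, ?_⟩
  have hl := G.len_pos d₀.1
  refine intervalIntegral.integral_pos hl (by fun_prop)
    (fun x _ => mul_nonneg (leafProfile_nonneg _ _ _ _) (mul_self_nonneg _))
    ⟨G.coord d₀ 0, coord_mem_Icc (left_mem_Icc.2 hl.le), ?_⟩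
  rw [value_onePair, leafProfile_self, coord_coord, sub_zero, mul_one, mul_one,
    max_eq_right hδ.le]
  exact hδ

theorem not_isMinOn_gap [DecidableEq V] (hG : G.IsTree) {u : G.Point → ℝ}
    (hu : G.IsEigenfunction 0 (G.eigenvalue 0 2) u) {v : V} (hv : G.IsLeaf v)
    (hlt : u (Point.vertex v) ^ 2 < 1 / G.totalLength * G.integral (fun x => u x ^ 2))
    {M : ℝ} (hM : 0 < M) : ¬ IsMinOn G.gap (G.convexClass M) 0 := by
  obtain ⟨d₀, rfl, huniq⟩ := hv.exists_unique_origin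
  have hloop : G.origin d₀ ≠ G.terminus d₀ := by
    rcases d₀ with ⟨e, _ | _⟩
    · simpa [origin, terminus] using (hG.loopless e).symm
    · simpa [origin, terminus] using hG.loopless e
  have hconn := hG.isTree.connected
  have hinc := exists_incident_edge hconn d₀
  have : Nonempty E := ⟨d₀.1⟩
  have hL := totalLength_pos G
  have hqp : ∀ e, ∀ x ∈ Icc 0 (G.len e), (0 : G.Point → ℝ) (G.pt e x) = (0 : C(ℝ, ℝ)) x :=
    fun _ _ _ => rfl
  have hp : ∀ e : E, ∀ x ∈ Icc 0 (G.len e), 0 ≤ (0 : C(ℝ, ℝ)) x := fun _ _ _ => le_rfl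
  obtain ⟨k, hk, rfl, hweak⟩ := hu.exists_weak hqp
  have hk0 : k ≠ 0 := by
    rintro rfl
    exact hu.1 toFun_zero
  have hN := massForm_self_pos hinc hk hk0 hp (hweak k hk)
  simp only [weightForm_zero_left, add_zero] at hweak
  rw [integral_toFun_sq hk] at hlt
  change k.1 (G.origin d₀) ^ 2 < _ at hlt
  -- If this eigenvalue were `0`, the eigenfunction would be constant and its square at the leaf
  -- would equal the mean, against the strict hypothesis.
  have hlam : 0 < G.eigenvalue 0 2 := by
    refine (nonneg_of_isEigenfunction hinc hqp hp hu).lt_of_ne fun h => ?_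
    have hD : G.dirichletForm k k = 0 := by rw [hweak k hk, ← h, zero_mul]
    have hmass : G.massForm k k = k.1 (G.origin d₀) ^ 2 * G.totalLength := by
      rw [weightForm_apply, totalLength, Finset.mul_sum]
      refine Finset.sum_congr rfl fun e _ => ?_
      simp only [value_eq_of_dirichletForm_eq_zero hconn hk hD (G.origin d₀), ContinuousMap.one_apply,
        intervalIntegral.integral_const, smul_eq_mul]
      ring
    rw [hmass, one_div, mul_comm, mul_assoc, mul_inv_cancel₀ hL.ne', mul_one] at hlt
    exact lt_irrefl _ hlt
  -- Room between the leaf value and the mean: by continuity the square stays below `m` within some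
  -- distance `ε` of the leaf, which fixes `δ`.
  obtain ⟨m, hm, hmN⟩ := exists_between hlt
  have hval0 : k.value d₀.1 (G.coord d₀ 0) = k.1 (G.origin d₀) := by
    rw [← toFun_pt hk (coord_mem_Icc (left_mem_Icc.2 (G.len_pos d₀.1).le)), pt_coord_zero]
    rfl
  have hcont : Continuous fun t => k.value d₀.1 (G.coord d₀ t) ^ 2 := by fun_prop
  obtain ⟨ε, hε, hball⟩ := Metric.eventually_nhds_iff.1
    ((hcont.tendsto 0).eventually_lt_const (by simpa only [hval0] using hm))
  obtain ⟨δ, hδ0, hδε, hδl⟩ : ∃ δ, 0 < δ ∧ δ ≤ ε ∧ δ ≤ G.len d₀.1 :=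
    ⟨min ε (G.len d₀.1), lt_min hε (G.len_pos _), min_le_left _ _, min_le_right _ _⟩
  have hA := weightForm_leafProfile_one_pos (G := G) d₀ hδ0
  have hW := weightForm_leafProfile_le (G := G) (d₀ := d₀) (δ := δ) (m := m) (k := k)
    fun t ht htδ => (hball (by
      rw [Real.dist_eq, sub_zero, abs_of_nonneg ht.1]
      exact htδ.trans_le hδε)).le
  have hquot : G.weightForm (G.leafProfile d₀ δ) k k / G.massForm k k <
      G.weightForm (G.leafProfile d₀ δ) G.onePair G.onePair / G.totalLength := by
    rw [div_lt_div_iff₀ hN hL]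
    have h1 : m * G.totalLength < G.massForm k k := by
      rw [one_div, inv_mul_eq_div] at hmN
      exact (lt_div_iff₀ hL).1 hmN
    have h2 := mul_le_mul_of_nonneg_right hW hL.le
    have h3 := mul_lt_mul_of_pos_left h1 hA
    linarith
  -- The cap `M / δ` on `s` keeps the scaled potential, whose maximum is `s * δ`, within `[0, M]`.
  obtain ⟨s, hs0, hsM, hgap⟩ := exists_gap_smul_lt hinc
    (fun e x hx => leafPotential_pt hloop huniq hδ0.le hδl hx)
    (fun e x _ => leafProfile_nonneg d₀ δ e x) hδ0.le
    (fun e x hx => leafProfile_le d₀ hδ0.le hx) hk hweak hlam hN hquot (div_pos hM hδ0)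
  intro hmin
  have hle := isMinOn_iff.1 hmin _ (smul_leafPotential_mem_convexClass hloop huniq hδ0.le hδl
    hs0.le ((le_div_iff₀ hδ0).1 hsM))
  exact absurd hgap (not_lt.2 hle)

/-- An eigenfunction of the Laplacian has positive square integral. -/
theorem IsEigenfunction.integral_sq_pos [DecidableEq V]
    (hinc : ∀ v, ∃ e, G.src e = v ∨ G.tgt e = v) {ν : ℝ}
    {u : G.Point → ℝ} (hu : G.IsEigenfunction 0 ν u) : 0 < G.integral fun x => u x ^ 2 := by
  have hqp : ∀ e, ∀ x ∈ Icc 0 (G.len e), (0 : G.Point → ℝ) (G.pt e x) = (0 : C(ℝ, ℝ)) x :=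
    fun _ _ _ => rfl
  obtain ⟨k, hk, rfl, hweak⟩ := hu.exists_weak hqp
  rw [integral_toFun_sq hk]
  refine massForm_self_pos hinc hk ?_ (fun _ _ _ => le_rfl) (hweak k hk)
  rintro rfl
  exact hu.1 toFun_zero

end Main

end MetricGraph

theorem mainTheorem5 {V E : Type*} [Fintype V] [DecidableEq V] [Fintype E]
    (G : MetricGraph V E) (hG : G.IsTree)
    (u₂ : G.Point → ℝ) (hu₂ : G.IsEigenfunction 0 (G.eigenvalue 0 2) u₂)
    (v : V) (hv : G.IsLeaf v) :
    (u₂ (MetricGraph.Point.vertex v) ^ 2 < 1 / G.totalLength * G.integral (fun x => u₂ x ^ 2) →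
      ∀ M : ℝ, 0 < M → ¬ IsMinOn G.gap (G.convexClass M) 0) ∧
    (u₂ (MetricGraph.Point.vertex v) = 0 →
      ∀ M : ℝ, 0 < M → ¬ IsMinOn G.gap (G.convexClass M) 0) := by
  refine ⟨fun hlt M hM => MetricGraph.not_isMinOn_gap hG hu₂ hv hlt hM,
    fun h0 M hM => MetricGraph.not_isMinOn_gap hG hu₂ hv ?_ hM⟩
  obtain ⟨d, -, -⟩ := hv.exists_unique_origin
  have hL : 0 < G.totalLength :=
    Finset.sum_pos (fun e _ => G.len_pos e) ⟨d.1, Finset.mem_univ _⟩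
  -- The second claim is a case of the first: a zero at the leaf lies below the mean of the square,
  -- which is positive.
  have hpos := hu₂.integral_sq_pos (MetricGraph.exists_incident_edge hG.isTree.connected d)
  rw [h0, sq, zero_mul]
  exact mul_pos (one_div_pos.2 hL) hpos
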